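/- Let $\mathbb{H}$ be the real quaternions, let $\mathbf{A}\in\mathbb{H}^{n\times n}$ and let $\mathbf{b}\in\mathbb{H}^{1\times n}$ be a constant row vector. Let $\operatorname{rank}$ denote the dimension of the left $\mathbb{H}$-space spanned by the rows of a matrix, let $k$ be the index of $\mathbf{A}$, i.e. the smallest positive integer with $\operatorname{rank}\mathbf{A}^{k+1}=\operatorname{rank}\mathbf{A}^{k}$, and let $r$ be this common rank. Write $\mathbf{M}^*$ for the conjugate transpose of $\mathbf{M}$. *Notation.* For a square quaternion matrix $\mathbf{M}=(m_{pq})$ whose rows and columns are indexed by a set $\alpha$ of $p$ integers, and $i\in\alpha$, the $i$-th row determinant is $$\operatorname{rdet}_i\mathbf{M}=\sum_{\sigma}(-1)^{p-c}\,(m_{i\,\sigma(i)}m_{\sigma(i)\,\sigma^2(i)}\cdots m_{\sigma^{l_1}(i)\,i})\,(m_{j_2\,\sigma(j_2)}\cdots m_{\sigma^{l_2}(j_2)\,j_2})\cdots(m_{j_c\,\sigma(j_c)}\cdots m_{\sigma^{l_c}(j_c)\,j_c}),$$ where $\sigma$ runs over all permutations of $\alpha$, $c$ is the number of cycles of $\sigma$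 (fixed points included), the first factor is the cycle through $i$ started at $i$, every other cycle is started at its least element $j_s$, and $j_2<\cdots<j_c$. For Hermitian $\mathbf{M}$, $\det\mathbf{M}$ is the common value of all its row determinants (the determinant of the empty matrix is $1$). $\mathbf{M}_\alpha^\alpha$ is the principal submatrix with rows and columns in $\alpha\subseteq\{1,\dots,n\}$, and $\mathbf{M}_{i.}(\mathbf{c})$ is $\mathbf{M}$ with its $i$-th row replaced by the row $\mathbf{c}$. Put $$R_i(\mathbf{M};\mathbf{c})=\sum_{|\alpha|=r,\ i\in\alpha}\operatorname{rdet}_i\big(\mathbf{M}_{i.}(\mathbf{c})\big)_\alpha^\alpha,\qquad d_r(\mathbf{M})=\sum_{|\alpha|=r}\det\mathbf{M}_\alpha^\alpha\quad(\mathbf{M}\text{ Hermitian}).$$ **Theorem.** There is exactly one matrix $\mathbf{A}^D$ (the Drazin inverse of $\mathbf{A}$) with $\mathbf{A}^D\mathbf{A}\mathbf{A}^D=\mathbf{A}^D$, $\mathbf{A}\mathbf{A}^D=\mathbf{A}^D\mathbf{A}$, $\mathbf{A}^{k+1}\mathbf{A}^D=\mathbf{A}^k$; the row-vector valued function $$\mathbf{x}(t)=-\mathbf{b}\mathbf{A}^D+\sum_{m=1}^{k}\frac{1}{m!}\left(\mathbf{b}\mathbf{A}^{m-1}-\mathbf{b}\mathbf{A}^{m}\mathbf{A}^D\right)t^m\qquad(t\in\mathbb{R})$$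 is a solution of the left system $\mathbf{x}'(t)=\mathbf{x}(t)\mathbf{A}+\mathbf{b}$; and its entries $x_i(t)$, $i=1,\dots,n$, have the following representations for all $t\in\mathbb{R}$. (i) If $\mathbf{A}$ is Hermitian, then $d_r(\mathbf{A}^{k+1})\neq0$ and $$x_i(t)=-\frac{R_i(\mathbf{A}^{k+1};\mathbf{b}\mathbf{A}^{k})}{d_r(\mathbf{A}^{k+1})}+\sum_{m=1}^{k}\frac{1}{m!}\left((\mathbf{b}\mathbf{A}^{m-1})_i-\frac{R_i(\mathbf{A}^{k+1};\mathbf{b}\mathbf{A}^{k+m})}{d_r(\mathbf{A}^{k+1})}\right)t^m .$$ (ii) For arbitrary $\mathbf{A}$, put $\mathbf{N}=\mathbf{A}^{2k+1}(\mathbf{A}^{2k+1})^*$ and $\mathbf{d}^{(l)}=\mathbf{b}\mathbf{A}^{k+l}(\mathbf{A}^{2k+1})^*$ for $l=0,\dots,k$. Then $d_r(\mathbf{N})\neq0$ and $$x_i(t)=-\frac{\sum_{s=1}^{n}R_s(\mathbf{N};\mathbf{d}^{(0)})\,(\mathbf{A}^{k})_{si}}{d_r(\mathbf{N})}+\sum_{m=1}^{k}\frac{1}{m!}\left((\mathbf{b}\mathbf{A}^{m-1})_i-\frac{\sum_{s=1}^{n}R_s(\mathbf{N};\mathbf{d}^{(m)})\,(\mathbf{A}^{k})_{si}}{d_r(\mathbf{N})}\right)t^m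 .$$ -/

import Mathlib

open scoped Quaternion Matrix

noncomputable section

namespace QuatLin

open Classical in
/-- The list of first elements of the disjoint cycles of `σ` (fixed points are cycles of length one):
first the distinguished index `i`, which opens its own cycle, and then, in increasing order, the
least elements of all the other cycles. -/
def cycleHeads {ι : Type} [Fintype ι] [LinearOrder ι] (σ : Equiv.Perm ι) (i : ι) : List ι :=
  i :: (Finset.univ.filter
    (fun j : ι => ¬ σ.SameCycle i j ∧ ∀ l : ι, σ.SameCycle j l → j ≤ l)).sort (· ≤ ·)

/-- The ordered product `a_{j, σ j} * a_{σ j, σ² j} * ⋯ * a_{σ^l j, j}` along the cycle of `σ`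
through `j` (of length `l + 1`), started at `j`. -/
def cycleProd {ι : Type} (A : Matrix ι ι ℍ[ℝ]) (σ : Equiv.Perm ι) (j : ι) : ℍ[ℝ] :=
  ((List.range (Function.minimalPeriod σ j)).map
    (fun m => A ((σ ^ m) j) ((σ ^ (m + 1)) j))).prod

/-- The `i`-th row determinant of a square quaternion matrix: the sum over all permutations `σ` of
`(-1) ^ (n - c)` (with `c` the number of cycles of `σ`) times the ordered product over the cycles. -/
def rdet {ι : Type} [Fintype ι] [LinearOrder ι] (i : ι) (A : Matrix ι ι ℍ[ℝ]) : ℍ[ℝ] :=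
  ∑ σ : Equiv.Perm ι,
    (-1 : ℍ[ℝ]) ^ (Fintype.card ι - (cycleHeads σ i).length) *
      ((cycleHeads σ i).map (cycleProd A σ)).prod

/-- The determinant of a Hermitian quaternion matrix, i.e. the common value of its row determinants;
it is computed along the first row, and it is `1` for the empty matrix. -/
def hdet {ι : Type} [Fintype ι] [LinearOrder ι] (A : Matrix ι ι ℍ[ℝ]) : ℍ[ℝ] :=
  if h : (Finset.univ : Finset ι).Nonempty then rdet (Finset.univ.min' h) A else 1

/-- The principal submatrix with rows and columns indexed by `α`. -/
def principal {n : ℕ} (A : Matrix (Fin n) (Fin n) ℍ[ℝ]) (α : Finset (Fin n)) :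
    Matrix α α ℍ[ℝ] :=
  A.submatrix Subtype.val Subtype.val

/-- The sum of the principal minors of order `r` of a Hermitian matrix `A`. -/
def minorSum {n : ℕ} (r : ℕ) (A : Matrix (Fin n) (Fin n) ℍ[ℝ]) : ℍ[ℝ] :=
  ∑ α : {α : Finset (Fin n) // α.card = r}, hdet (principal A α.1)

/-- `∑ rdet_i ((A_{i.}(c))_α^α)`, summed over the index sets `α` of size `r` containing `i`; here
`A_{i.}(c)` is `A` with its `i`-th row replaced by the row `c`. -/
def rdetSum {n : ℕ} (r : ℕ) (A : Matrix (Fin n) (Fin n) ℍ[ℝ]) (i : Fin n)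
    (c : Fin n → ℍ[ℝ]) : ℍ[ℝ] :=
  ∑ α : {α : Finset (Fin n) // α.card = r ∧ i ∈ α},
    rdet (⟨i, α.2.2⟩ : α.1) (principal (A.updateRow i c) α.1)

/-- The rank of a quaternion matrix: the dimension of the left vector space spanned by its rows. -/
def qrank {n : ℕ} (A : Matrix (Fin n) (Fin n) ℍ[ℝ]) : ℕ :=
  Module.finrank ℍ[ℝ] (Submodule.span ℍ[ℝ] (Set.range (fun i : Fin n => A i)))

/-- `k` is the index of `A`: the smallest positive integer with `rank A ^ (k + 1) = rank A ^ k`. -/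
def IsIndex {n : ℕ} (A : Matrix (Fin n) (Fin n) ℍ[ℝ]) (k : ℕ) : Prop :=
  IsLeast {m : ℕ | 0 < m ∧ qrank (A ^ (m + 1)) = qrank (A ^ m)} k

/-- The equations that define the Drazin inverse `X` of a matrix `A` of index `k`. -/
structure IsDrazinInverse {n : ℕ} (A : Matrix (Fin n) (Fin n) ℍ[ℝ]) (k : ℕ)
    (X : Matrix (Fin n) (Fin n) ℍ[ℝ]) : Prop where
  outer : X * A * X = X
  comm : A * X = X * A
  pow_succ_mul : A ^ (k + 1) * X = A ^ k

/-- The row-vector valued function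
`X(t) = -b D + ∑_{m=1}^{k} (1 / m!) (b A^{m-1} - b A^m D) t^m`. -/
def partialSolution {n : ℕ} (A D : Matrix (Fin n) (Fin n) ℍ[ℝ]) (k : ℕ) (b : Fin n → ℍ[ℝ])
    (t : ℝ) : Fin n → ℍ[ℝ] :=
  -(b ᵥ* D) + ∑ m ∈ Finset.Icc 1 k,
    (t ^ m / (m.factorial : ℝ)) • (b ᵥ* A ^ (m - 1) - b ᵥ* (A ^ m * D))

end QuatLin

end

/-!
The Drazin inverse and its determinantal representation both come from one matrix identity for
Hermitian quaternion matrices `H`. Let `B m` be the matrix (`minorAdjugate`) with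
`rdetSum m H i c = (c * B m) i`, and let `d m` be the sum of the principal minors of order `m`. Then
`B (m + 1) = d m - H * B m`, with `d m` real (`minorAdjugate_succ`).

To prove it, a row determinant is expanded by cutting vertices out of the cycle through `i`
(`rowDet_expand`), which turns it into a sum over subsets `V` of a signed sum over the paths through
exactly the vertices in `V`, times the determinant of the remaining indices
(`rowDet_eq_sum_pathSum`). For Hermitian `H`, reversal of paths is conjugation, so closed path sums
are real and central. This is all the commutativity that is needed to show that the row determinants
of a Hermitian matrix coincide (`fullDet_insert`) and that a row determinant vanishes when its row
is replaced by another one (`rowDet_eq_zero`).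

Let `s` be the largest order with `d s ≠ 0`. The recursion makes `B (s + 1)` a matrix that is killed
by a power of `H`, hence by `H` itself, so that `H * B s / d s` is an idempotent with the row space
of `H`. The trace of `B (s + 1)` is `(n - s) * d s`, which shows that this idempotent has trace `s`;
as the real trace of an idempotent is its rank, `s` is the rank of `H` (`minorAdjugate_qrank`). No
spectral theorem is used.

Applied to `M * Mᴴ` with `M = A ^ (2 * k + 1)`, this yields an inner inverse of `M`
(`inner_inverse_minorAdjugate`), from which the Drazin inverse of `A` is obtained by multiplication
with `A ^ k` on both sides. If `A` is Hermitian, `A ^ (k + 1)` can be used directly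
(`pow_mul_minorAdjugate`).
-/

namespace QuatLin

/-! ### Orbits of a permutation and products along them -/

section Orbits

variable {ι κ : Type}

theorem cycleProd_congr {A : Matrix ι ι ℍ[ℝ]} {B : Matrix κ κ ℍ[ℝ]}
    {σ : Equiv.Perm ι} {τ : Equiv.Perm κ} {j : ι} {j' : κ}
    (hper : Function.minimalPeriod σ j = Function.minimalPeriod τ j')
    (hAB : ∀ m, A ((σ ^ m) j) ((σ ^ (m + 1)) j) = B ((τ ^ m) j') ((τ ^ (m + 1)) j')) :
    cycleProd A σ j = cycleProd B τ j' := by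
  unfold cycleProd
  rw [hper]
  congr 1
  exact List.map_congr_left fun m _ => hAB m

theorem minimalPeriod_congr {σ : Equiv.Perm ι} {τ : Equiv.Perm κ} {j : ι} {j' : κ}
    (h : ∀ m : ℕ, (σ ^ m) j = j ↔ (τ ^ m) j' = j') :
    Function.minimalPeriod σ j = Function.minimalPeriod τ j' := by
  rw [Function.minimalPeriod_eq_minimalPeriod_iff]
  intro m
  simp only [Function.IsPeriodicPt, Function.IsFixedPt, Equiv.Perm.iterate_eq_pow]
  exact h m

theorem minimalPeriod_perm_pos [Finite ι] (σ : Equiv.Perm ι) (j : ι) :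
    0 < Function.minimalPeriod σ j := by
  apply Function.minimalPeriod_pos_of_mem_periodicPts
  refine ⟨orderOf σ, orderOf_pos σ, ?_⟩
  simp [Function.IsPeriodicPt, Function.IsFixedPt, Equiv.Perm.iterate_eq_pow, pow_orderOf_eq_one]

theorem pow_apply_ne_of_lt_minimalPeriod {σ : Equiv.Perm ι} {j : ι} {m : ℕ} (h0 : m ≠ 0)
    (hm : m < Function.minimalPeriod σ j) : (σ ^ m) j ≠ j := by
  have := Function.not_isPeriodicPt_of_pos_of_lt_minimalPeriod h0 hm
  simpa [Function.IsPeriodicPt, Function.IsFixedPt, Equiv.Perm.iterate_eq_pow] using this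

theorem pow_minimalPeriod_apply (σ : Equiv.Perm ι) (j : ι) :
    (σ ^ Function.minimalPeriod σ j) j = j := by
  rw [← Equiv.Perm.iterate_eq_pow]
  exact Function.isPeriodicPt_minimalPeriod σ j

theorem minimalPeriod_eq_of [Finite ι] {σ : Equiv.Perm ι} {j : ι} {p : ℕ} (hp : 0 < p)
    (h : (σ ^ p) j = j) (hne : ∀ m, m ≠ 0 → m < p → (σ ^ m) j ≠ j) :
    Function.minimalPeriod σ j = p := by
  apply le_antisymm
  · apply Function.IsPeriodicPt.minimalPeriod_le hp
    simpa [Function.IsPeriodicPt, Function.IsFixedPt, Equiv.Perm.iterate_eq_pow] using h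
  · by_contra hlt
    exact hne _ (minimalPeriod_perm_pos σ j).ne' (not_le.mp hlt) (pow_minimalPeriod_apply σ j)

theorem sameCycle_congr_of_pow [Finite κ] {σ τ : Equiv.Perm κ} {j : κ}
    (h : ∀ m : ℕ, (τ ^ m) j = (σ ^ m) j) (l : κ) : τ.SameCycle j l ↔ σ.SameCycle j l := by
  constructor
  · intro hl
    obtain ⟨m, rfl⟩ := hl.exists_nat_pow_eq
    rw [h]
    exact Equiv.Perm.sameCycle_pow_right.2 (Equiv.Perm.SameCycle.refl _ _)
  · intro hl
    obtain ⟨m, rfl⟩ := hl.exists_nat_pow_eq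
    rw [← h]
    exact Equiv.Perm.sameCycle_pow_right.2 (Equiv.Perm.SameCycle.refl _ _)

theorem neg_one_pow_commute (m : ℕ) (x : ℍ[ℝ]) : Commute ((-1 : ℍ[ℝ]) ^ m) x :=
  (Commute.neg_one_left x).pow_left m

theorem cycleProd_updateRow_of_not_sameCycle [DecidableEq ι] (A : Matrix ι ι ℍ[ℝ]) 
    (u : ι → ℍ[ℝ]) {σ : Equiv.Perm ι} {i j : ι} (h : ¬ σ.SameCycle i j) :
    cycleProd (A.updateRow i u) σ j = cycleProd A σ j := by
  apply cycleProd_congr rfl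
  intro m
  rw [Matrix.updateRow_ne]
  intro hm
  apply h
  rw [← hm]
  exact Equiv.Perm.sameCycle_pow_left.2 (Equiv.Perm.SameCycle.refl _ _)

/-- If `σ i = c`, then `σ * swap i c` is `σ` with `c` cut out of its cycle. It agrees with `σ` along
every cycle that avoids `i`. -/
theorem contract_pow_of_not_sameCycle [DecidableEq ι] {σ τ : Equiv.Perm ι} {i c : ι}
    (hτ : τ = σ * Equiv.swap i c) (hc : σ i = c) {j : ι}
    (hj : ¬ σ.SameCycle i j) (m : ℕ) : (τ ^ m) j = (σ ^ m) j := by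
  induction m with
  | zero => rfl
  | succ m ih =>
    have h1 : (σ ^ m) j ≠ i := by
      intro h
      exact hj (h ▸ Equiv.Perm.sameCycle_pow_left.2 (Equiv.Perm.SameCycle.refl _ _))
    have h2 : (σ ^ m) j ≠ c := by
      intro h
      apply hj
      have : σ.SameCycle c j := h ▸ Equiv.Perm.sameCycle_pow_left.2 (Equiv.Perm.SameCycle.refl _ _)
      rw [← hc] at this
      exact Equiv.Perm.sameCycle_apply_left.1 this
    rw [pow_succ', pow_succ', Equiv.Perm.mul_apply, Equiv.Perm.mul_apply, ih, hτ,
      Equiv.Perm.mul_apply, Equiv.swap_apply_of_ne_of_ne h1 h2]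

theorem contract_pow_of_not_sameCycle_contract [DecidableEq ι] {σ τ : Equiv.Perm ι} {i c : ι}
    (hτ : τ = σ * Equiv.swap i c) (hc : σ i = c) {j : ι}
    (hjc : j ≠ c) (hj : ¬ τ.SameCycle i j) (m : ℕ) : (τ ^ m) j = (σ ^ m) j := by
  have hfix : τ c = c := by rw [hτ, Equiv.Perm.mul_apply, Equiv.swap_apply_right, hc]
  induction m with
  | zero => rfl
  | succ m ih =>
    have h1 : (τ ^ m) j ≠ i := by
      intro h
      exact hj (h ▸ Equiv.Perm.sameCycle_pow_left.2 (Equiv.Perm.SameCycle.refl _ _))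
    have h2 : (τ ^ m) j ≠ c := by
      intro h
      apply hjc
      apply (τ ^ m).injective
      rw [h, Equiv.Perm.pow_apply_eq_self_of_apply_eq_self hfix]
    rw [pow_succ', pow_succ', Equiv.Perm.mul_apply, Equiv.Perm.mul_apply, ← ih]
    generalize (τ ^ m) j = y at h1 h2
    rw [hτ, Equiv.Perm.mul_apply, Equiv.swap_apply_of_ne_of_ne h1 h2]

end Orbits

/-! ### Row determinants of principal submatrices and their expansion along a row -/

section Expansion

variable {ι : Type} [Fintype ι] [LinearOrder ι]

open Classical in
/-- The permutations of `ι` that move only elements of `S`; they stand for the permutations of `S`,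
so that all index sets `S` can be treated inside one type. -/
def permsOn (S : Finset ι) : Finset (Equiv.Perm ι) :=
  Finset.univ.filter (fun σ => ∀ x, x ∉ S → σ x = x)

open Classical in
/-- The least elements of the cycles of `σ` that lie in `S` (fixed points included). -/
def cycleMinima (S : Finset ι) (σ : Equiv.Perm ι) : Finset ι :=
  S.filter (fun j => ∀ l, σ.SameCycle j l → j ≤ l)

open Classical in
/-- The least elements of those cycles of `σ` in `T` that do not pass through `i`. -/
def otherMinima (i : ι) (T : Finset ι) (σ : Equiv.Perm ι) : Finset ι :=
  T.filter (fun j => ¬ σ.SameCycle i j ∧ ∀ l, σ.SameCycle j l → j ≤ l)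

/-- The product of the cycle products started at the elements of `S`, in increasing order. -/
noncomputable def cycleProds (A : Matrix ι ι ℍ[ℝ]) (σ : Equiv.Perm ι) (S : Finset ι) : ℍ[ℝ] :=
  ((S.sort (· ≤ ·)).map (cycleProd A σ)).prod

/-- The determinant of the principal submatrix on `S`, with every cycle, the first one included,
started at its least element. The exponent `|S| + c` has the parity of `|S| - c`. -/
noncomputable def fullDet (A : Matrix ι ι ℍ[ℝ]) (S : Finset ι) : ℍ[ℝ] :=
  ∑ σ ∈ permsOn S, (-1 : ℍ[ℝ]) ^ (S.card + (cycleMinima S σ).card) *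
    cycleProds A σ (cycleMinima S σ)

/-- The `i`-th row determinant of the principal submatrix on `insert i T` (for `i ∉ T`) of the
matrix `A` with `i`-th row replaced by `u`. The cycle through `i` is counted neither in `|T|` nor
in the number of other cycles, so the sign is that of `(-1) ^ (|insert i T| - c)`. -/
noncomputable def rowDet (A : Matrix ι ι ℍ[ℝ]) (u : ι → ℍ[ℝ]) (i : ι) (T : Finset ι) : ℍ[ℝ] :=
  ∑ σ ∈ permsOn (insert i T), (-1 : ℍ[ℝ]) ^ (T.card + (otherMinima i T σ).card) *
    (cycleProd (A.updateRow i u) σ i * cycleProds A σ (otherMinima i T σ))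

theorem mem_permsOn {S : Finset ι} {σ : Equiv.Perm ι} :
    σ ∈ permsOn S ↔ ∀ x, x ∉ S → σ x = x := by
  simp [permsOn]

theorem mem_cycleMinima {S : Finset ι} {σ : Equiv.Perm ι} {j : ι} :
    j ∈ cycleMinima S σ ↔ j ∈ S ∧ ∀ l, σ.SameCycle j l → j ≤ l := by
  simp [cycleMinima]

theorem mem_otherMinima {i : ι} {T : Finset ι} {σ : Equiv.Perm ι} {j : ι} :
    j ∈ otherMinima i T σ ↔ j ∈ T ∧ ¬ σ.SameCycle i j ∧ ∀ l, σ.SameCycle j l → j ≤ l := by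
  simp [otherMinima]

/-- Only the first factor of the cycle product started at `i` sees the row `i`. -/
theorem cycleProd_updateRow_self (A : Matrix ι ι ℍ[ℝ]) (u : ι → ℍ[ℝ]) (σ : Equiv.Perm ι) (i : ι) :
    cycleProd (A.updateRow i u) σ i = u (σ i) *
      ((List.range (Function.minimalPeriod σ i - 1)).map
        (fun m => A ((σ ^ (m + 1)) i) ((σ ^ (m + 2)) i))).prod := by
  unfold cycleProd
  obtain ⟨p, hp⟩ := Nat.exists_eq_succ_of_ne_zero (minimalPeriod_perm_pos σ i).ne'
  rw [hp, Nat.succ_eq_add_one, List.range_succ_eq_map]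
  simp only [List.map_cons, List.prod_cons, List.map_map, Nat.add_sub_cancel]
  congr 1
  · simp
  · congr 1
    apply List.map_congr_left
    intro m hm
    rw [List.mem_range] at hm
    have : (σ ^ (m + 1)) i ≠ i :=
      pow_apply_ne_of_lt_minimalPeriod (Nat.succ_ne_zero m) (by omega)
    simp only [Function.comp, Nat.succ_eq_add_one]
    rw [Matrix.updateRow_ne this]

section Contract

variable {σ τ : Equiv.Perm ι} {i c : ι}

theorem contract_not_sameCycle_iff (hτ : τ = σ * Equiv.swap i c) (hc : σ i = c) (hic : i ≠ c)
    {j : ι} : ¬ σ.SameCycle i j ↔ j ≠ c ∧ ¬ τ.SameCycle i j := by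
  constructor
  · intro h
    refine ⟨?_, fun h' => h ?_⟩
    · rintro rfl
      apply h
      rw [← hc]
      exact Equiv.Perm.sameCycle_apply_right.2 (Equiv.Perm.SameCycle.refl _ _)
    · exact ((sameCycle_congr_of_pow (contract_pow_of_not_sameCycle hτ hc h) i).1 h'.symm).symm
  · rintro ⟨h1, h2⟩ h'
    exact h2
      ((sameCycle_congr_of_pow
        (contract_pow_of_not_sameCycle_contract hτ hc h1 h2) i).2 h'.symm).symm

theorem otherMinima_contract (hτ : τ = σ * Equiv.swap i c) (hc : σ i = c) (hic : i ≠ c)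
    (T : Finset ι) : otherMinima i T σ = otherMinima i (T.erase c) τ := by
  ext j
  rw [mem_otherMinima, mem_otherMinima, Finset.mem_erase,
    contract_not_sameCycle_iff hτ hc hic]
  constructor
  · rintro ⟨h1, ⟨h2, h3⟩, h4⟩
    refine ⟨⟨h2, h1⟩, h3, fun l hl => h4 l ?_⟩
    exact (sameCycle_congr_of_pow (contract_pow_of_not_sameCycle_contract hτ hc h2 h3) l).1 hl
  · rintro ⟨⟨h2, h1⟩, h3, h4⟩
    refine ⟨h1, ⟨h2, h3⟩, fun l hl => h4 l ?_⟩
    exact (sameCycle_congr_of_pow (contract_pow_of_not_sameCycle_contract hτ hc h2 h3) l).2 hl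

theorem cycleProds_otherMinima_contract (hτ : τ = σ * Equiv.swap i c) (hc : σ i = c)
    (A : Matrix ι ι ℍ[ℝ]) (T : Finset ι) :
    cycleProds A σ (otherMinima i T σ) = cycleProds A τ (otherMinima i T σ) := by
  unfold cycleProds
  congr 1
  apply List.map_congr_left
  intro j hj
  rw [Finset.mem_sort, mem_otherMinima] at hj
  have h := contract_pow_of_not_sameCycle hτ hc hj.2.1
  apply cycleProd_congr
  · apply minimalPeriod_congr
    intro m
    rw [h]
  · intro m
    rw [h, h]

/-- Cutting `c = σ i` out of the cycle of `σ` through `i` takes off the first factor of the cycle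
product, after which the next factor is read off from row `c`. -/
theorem cycleProd_contract (hτ : τ = σ * Equiv.swap i c) (hc : σ i = c) (hic : i ≠ c)
    (A : Matrix ι ι ℍ[ℝ]) (u : ι → ℍ[ℝ]) :
    cycleProd (A.updateRow i u) σ i = u c * cycleProd (A.updateRow i (A c)) τ i := by
  set p := Function.minimalPeriod σ i with hp
  have hp2 : 2 ≤ p := by
    by_contra hlt
    have h1 : p = 1 := by have := minimalPeriod_perm_pos σ i; omega
    have := pow_minimalPeriod_apply σ i
    rw [← hp, h1, pow_one, hc] at this
    exact hic this.symm
  have hpow : ∀ m, m ≠ 0 → m < p → (τ ^ m) i = (σ ^ (m + 1)) i := by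
    intro m
    induction m with
    | zero => intro h; exact absurd rfl h
    | succ m ih =>
      intro _ hm
      rcases Nat.eq_zero_or_pos m with rfl | hm0
      · rw [zero_add, pow_one, hτ, Equiv.Perm.mul_apply, Equiv.swap_apply_left, ← hc]
        rfl
      · have h1 : (σ ^ (m + 1)) i ≠ i := pow_apply_ne_of_lt_minimalPeriod (Nat.succ_ne_zero m) hm
        have h2 : (σ ^ (m + 1)) i ≠ c := by
          intro h
          rw [pow_succ', Equiv.Perm.mul_apply, ← hc] at h
          exact pow_apply_ne_of_lt_minimalPeriod hm0.ne' (by omega) (σ.injective h)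
        rw [pow_succ', Equiv.Perm.mul_apply, ih hm0.ne' (by omega)]
        conv_lhs => rw [hτ]
        rw [Equiv.Perm.mul_apply, Equiv.swap_apply_of_ne_of_ne h1 h2, pow_succ' σ (m + 1),
          Equiv.Perm.mul_apply]
  have hpτ : Function.minimalPeriod τ i = p - 1 := by
    apply minimalPeriod_eq_of (by omega)
    · rw [hpow _ (by omega) (by omega), Nat.sub_add_cancel (by omega)]
      exact pow_minimalPeriod_apply σ i
    · intro m h0 hm
      rw [hpow m h0 (by omega)]
      exact pow_apply_ne_of_lt_minimalPeriod (Nat.succ_ne_zero m) (by omega)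
  rw [cycleProd_updateRow_self, cycleProd_updateRow_self, hpτ, ← hp, hc]
  congr 1
  obtain ⟨q, hq⟩ : ∃ q, p = q + 2 := ⟨p - 2, by omega⟩
  have e1 : p - 1 = q + 1 := by omega
  have e2 : p - 1 - 1 = q := by omega
  rw [e2, e1, List.range_succ_eq_map]
  simp only [List.map_cons, List.prod_cons, List.map_map]
  congr 1
  · have h1 : τ i = (σ ^ 2) i := by simpa using hpow 1 one_ne_zero (by omega)
    rw [h1, zero_add, pow_one, hc, zero_add]
  · congr 1
    apply List.map_congr_left
    intro m hm
    rw [List.mem_range] at hm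
    simp only [Function.comp, Nat.succ_eq_add_one]
    rw [hpow (m + 1) (Nat.succ_ne_zero m) (by omega),
      hpow (m + 2) (Nat.succ_ne_zero _) (by omega)]

end Contract

theorem cycleProds_empty {ι : Type} [LinearOrder ι] (A : Matrix ι ι ℍ[ℝ]) (σ : Equiv.Perm ι) :
    cycleProds A σ ∅ = 1 := by
  simp [cycleProds]

theorem fullDet_empty (A : Matrix ι ι ℍ[ℝ]) : fullDet A ∅ = 1 := by
  have h : permsOn (∅ : Finset ι) = {1} := by
    ext σ
    simp [mem_permsOn, Equiv.ext_iff]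
  have h2 : cycleMinima (∅ : Finset ι) 1 = ∅ := by simp [cycleMinima]
  simp [fullDet, h, h2, cycleProds_empty]

theorem otherMinima_of_fixed {σ : Equiv.Perm ι} {i : ι} {T : Finset ι} (hi : i ∉ T)
    (hσ : σ i = i) : otherMinima i T σ = cycleMinima T σ := by
  ext j
  rw [mem_otherMinima, mem_cycleMinima]
  constructor
  · exact fun h => ⟨h.1, h.2.2⟩
  · refine fun h => ⟨h.1, fun h' => hi ?_, h.2⟩
    obtain ⟨m, hm⟩ := h'.exists_nat_pow_eq
    rw [Equiv.Perm.pow_apply_eq_self_of_apply_eq_self hσ] at hm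
    exact hm ▸ h.1

theorem cycleProd_updateRow_of_fixed (A : Matrix ι ι ℍ[ℝ]) (u : ι → ℍ[ℝ]) {σ : Equiv.Perm ι}
    {i : ι} (hσ : σ i = i) : cycleProd (A.updateRow i u) σ i = u i := by
  have : Function.minimalPeriod σ i = 1 := by
    rw [Function.minimalPeriod_eq_one_iff_isFixedPt]; exact hσ
  rw [cycleProd_updateRow_self, this, hσ]
  simp

/-- Expansion of a row determinant according to the successor `c` of `i`: either `i` is fixed, or
`c` can be cut out of the cycle of `i`, whose product then goes on with row `c`. It holds for every
matrix, Hermitian or not. -/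
theorem rowDet_expand (A : Matrix ι ι ℍ[ℝ]) (u : ι → ℍ[ℝ]) {i : ι} {T : Finset ι} (hi : i ∉ T) :
    rowDet A u i T = u i * fullDet A T - ∑ c ∈ T, u c * rowDet A (A c) i (T.erase c) := by
  classical
  have hmaps : ∀ σ ∈ permsOn (insert i T), σ i ∈ insert i T := by
    intro σ hσ
    by_contra h
    have h1 := mem_permsOn.1 hσ _ h
    have h2 := σ.injective h1
    rw [h2] at h
    exact h (Finset.mem_insert_self _ _)
  unfold rowDet
  rw [← Finset.sum_fiberwise_of_maps_to hmaps, Finset.sum_insert hi, sub_eq_add_neg,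
    ← Finset.sum_neg_distrib]
  congr 1
  · rw [fullDet, Finset.mul_sum]
    refine Finset.sum_congr ?_ ?_
    · ext σ
      rw [Finset.mem_filter, mem_permsOn, mem_permsOn]
      constructor
      · rintro ⟨h1, h2⟩ x hx
        rcases eq_or_ne x i with rfl | hxi
        · exact h2
        · exact h1 x (by simp [hx, hxi])
      · intro h
        exact ⟨fun x hx => h x (fun h' => hx (Finset.mem_insert_of_mem h')), h i hi⟩
    · intro σ hσ
      have hf : σ i = i := mem_permsOn.1 hσ i hi
      rw [otherMinima_of_fixed hi hf, cycleProd_updateRow_of_fixed A u hf, ← mul_assoc,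
        (neg_one_pow_commute _ _).eq, mul_assoc]
  · refine Finset.sum_congr rfl fun c hcT => ?_
    have hic : i ≠ c := fun h => hi (h ▸ hcT)
    rw [Finset.mul_sum, ← Finset.sum_neg_distrib]
    refine Finset.sum_bij' (fun σ _ => σ * Equiv.swap i c) (fun τ _ => τ * Equiv.swap i c)
      ?_ ?_ ?_ ?_ ?_
    · intro σ hσ
      rw [Finset.mem_filter, mem_permsOn] at hσ
      rw [mem_permsOn]
      intro x hx
      rw [Finset.mem_insert, Finset.mem_erase, not_or, not_and] at hx
      rw [Equiv.Perm.mul_apply]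
      rcases eq_or_ne x c with rfl | hxc
      · rw [Equiv.swap_apply_right, hσ.2]
      · rw [Equiv.swap_apply_of_ne_of_ne hx.1 hxc]
        exact hσ.1 x (by simp [hx.1, hx.2 hxc])
    · intro τ hτ
      rw [mem_permsOn] at hτ
      have hτc : τ c = c := hτ c (by simp [hic.symm])
      rw [Finset.mem_filter, mem_permsOn]
      refine ⟨fun x hx => ?_, ?_⟩
      · rw [Finset.mem_insert, not_or] at hx
        have hxc : x ≠ c := fun h => hx.2 (h ▸ hcT)
        rw [Equiv.Perm.mul_apply, Equiv.swap_apply_of_ne_of_ne hx.1 hxc]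
        exact hτ x (by simp [hx.1, hx.2])
      · rw [Equiv.Perm.mul_apply, Equiv.swap_apply_left, hτc]
    · intro σ _
      simp [mul_assoc]
    · intro σ _
      simp [mul_assoc]
    · intro σ hσ
      rw [Finset.mem_filter] at hσ
      have hc := hσ.2
      set τ := σ * Equiv.swap i c with hτ
      rw [cycleProds_otherMinima_contract hτ hc, otherMinima_contract hτ hc hic,
        cycleProd_contract hτ hc hic, Finset.card_erase_of_mem hcT]
      have hpos : 0 < T.card := Finset.card_pos.2 ⟨c, hcT⟩
      have e : T.card + (otherMinima i (T.erase c) τ).card =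
        (T.card - 1 + (otherMinima i (T.erase c) τ).card) + 1 := by omega
      rw [e, pow_succ, mul_neg_one, neg_mul, ← mul_assoc (u c), ← (neg_one_pow_commute _ (u c)).eq]
      simp only [mul_assoc]

/-- With `m` the least index, the cycle through `m` comes first in either convention. -/
theorem fullDet_eq_rowDet_of_least (A : Matrix ι ι ℍ[ℝ]) {T : Finset ι} {m : ι} (hm : m ∈ T)
    (hmin : ∀ x ∈ T, m ≤ x) : fullDet A T = rowDet A (A m) m (T.erase m) := by
  unfold fullDet rowDet
  rw [Finset.insert_erase hm]
  refine Finset.sum_congr rfl fun σ hσ => ?_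
  have hcyc : ∀ l, σ.SameCycle m l → l ∈ T := by
    intro l hl
    by_contra h
    have hf := mem_permsOn.1 hσ l h
    obtain ⟨a, ha⟩ := hl.symm.exists_nat_pow_eq
    rw [Equiv.Perm.pow_apply_eq_self_of_apply_eq_self hf] at ha
    exact h (ha ▸ hm)
  have h1 : cycleMinima T σ = insert m (otherMinima m (T.erase m) σ) := by
    ext j
    rw [mem_cycleMinima, Finset.mem_insert, mem_otherMinima, Finset.mem_erase]
    constructor
    · rintro ⟨hj, hl⟩
      rcases eq_or_ne j m with h | h
      · exact Or.inl h
      · refine Or.inr ⟨⟨h, hj⟩, fun h' => h ?_, hl⟩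
        exact le_antisymm (hl m h'.symm) (hmin j hj)
    · rintro (rfl | h)
      · exact ⟨hm, fun l hl => hmin l (hcyc l hl)⟩
      · exact ⟨h.1.2, h.2.2⟩
  have h2 : m ∉ otherMinima m (T.erase m) σ := by simp [mem_otherMinima]
  have h3 : ∀ b ∈ otherMinima m (T.erase m) σ, m ≤ b := fun b hb =>
    hmin b (Finset.mem_of_mem_erase (mem_otherMinima.1 hb).1)
  have hpos : 0 < T.card := Finset.card_pos.2 ⟨m, hm⟩
  have e : T.card + (cycleMinima T σ).card =
      (T.erase m).card + (otherMinima m (T.erase m) σ).card + 2 := by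
    rw [h1, Finset.card_insert_of_notMem h2, Finset.card_erase_of_mem hm]
    omega
  rw [e, pow_add, Even.neg_one_pow (by decide : Even 2), mul_one, Matrix.updateRow_eq_self, h1]
  congr 1
  unfold cycleProds
  rw [Finset.sort_insert _ h3 h2, List.map_cons, List.prod_cons]

/-- Extending permutations of the subtype `α` by the identity identifies `rdet` on `α` with
`rowDet`. -/
theorem rdet_principal_updateRow {n : ℕ} (A : Matrix (Fin n) (Fin n) ℍ[ℝ]) (u : Fin n → ℍ[ℝ])
    {α : Finset (Fin n)} {i : Fin n} (hi : i ∈ α) :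
    rdet (⟨i, hi⟩ : α) (principal (A.updateRow i u) α) = rowDet A u i (α.erase i) := by
  classical
  unfold rdet rowDet
  rw [Finset.insert_erase hi]
  have hpow : ∀ (σ : Equiv.Perm α) (m : ℕ) (x : α),
      ((Equiv.Perm.ofSubtype σ : Equiv.Perm (Fin n)) ^ m) x = ((σ ^ m) x : α) := by
    intro σ m x
    rw [← map_pow, Equiv.Perm.ofSubtype_apply_coe]
  have hsame : ∀ (σ : Equiv.Perm α) (x y : α),
      (Equiv.Perm.ofSubtype σ : Equiv.Perm (Fin n)).SameCycle x y ↔ σ.SameCycle x y := by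
    intro σ x y
    constructor
    · intro h
      obtain ⟨m, hm⟩ := h.exists_nat_pow_eq
      rw [hpow] at hm
      rw [← Subtype.ext hm]
      exact Equiv.Perm.sameCycle_pow_right.2 (Equiv.Perm.SameCycle.refl _ _)
    · intro h
      obtain ⟨m, rfl⟩ := h.exists_nat_pow_eq
      rw [← hpow]
      exact Equiv.Perm.sameCycle_pow_right.2 (Equiv.Perm.SameCycle.refl _ _)
  have hfix : ∀ σ : Equiv.Perm α, ∀ x, x ∉ α →
      (Equiv.Perm.ofSubtype σ : Equiv.Perm (Fin n)) x = x := fun σ x hx =>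
    Equiv.Perm.ofSubtype_apply_of_not_mem σ hx
  have hmem : ∀ (σ : Equiv.Perm α) (x : α) (l : Fin n),
      (Equiv.Perm.ofSubtype σ : Equiv.Perm (Fin n)).SameCycle x l → l ∈ α := by
    intro σ x l h
    obtain ⟨m, hm⟩ := h.exists_nat_pow_eq
    rw [hpow] at hm
    rw [← hm]
    exact Subtype.mem _
  refine Finset.sum_bij (fun σ _ => Equiv.Perm.ofSubtype σ) ?_ ?_ ?_ ?_
  · intro σ _
    rw [mem_permsOn]
    exact hfix σ
  · intro σ _ τ _ h
    exact Equiv.Perm.ofSubtype_injective h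
  · intro τ hτ
    rw [mem_permsOn] at hτ
    have h1 : ∀ x, τ x ∈ α ↔ x ∈ α := by
      intro x
      constructor
      · intro h
        by_contra hx
        rw [hτ x hx] at h
        exact hx h
      · intro h
        by_contra hx
        exact hx (by rw [τ.injective (hτ _ hx)]; exact h)
    exact ⟨τ.subtypePerm h1, Finset.mem_univ _, Equiv.Perm.ofSubtype_subtypePerm h1
      (fun x hx => by by_contra h; exact hx (hτ x h))⟩
  · intro σ _
    set τ : Equiv.Perm (Fin n) := Equiv.Perm.ofSubtype σ with hτ
    set F : Finset α := Finset.univ.filter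
      (fun j : α => ¬ σ.SameCycle ⟨i, hi⟩ j ∧ ∀ l : α, σ.SameCycle j l → j ≤ l) with hF
    have hheads : cycleHeads σ ⟨i, hi⟩ = ⟨i, hi⟩ :: F.sort (· ≤ ·) := by
      unfold cycleHeads
      rw [hF]
      congr!
    have hmap : F.map (Function.Embedding.subtype _) = otherMinima i (α.erase i) τ := by
      ext j
      rw [mem_otherMinima]
      simp only [hF, Finset.mem_map, Finset.mem_filter, Finset.mem_univ, true_and,
        Function.Embedding.subtype_apply, Subtype.exists, exists_and_right, exists_eq_right]
      constructor
      · rintro ⟨hj, h1, h2⟩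
        refine ⟨Finset.mem_erase.2 ⟨?_, hj⟩, fun h => h1 ((hsame σ ⟨i, hi⟩ ⟨j, hj⟩).1 h),
          fun l hl => ?_⟩
        · rintro rfl
          exact h1 (Equiv.Perm.SameCycle.refl _ _)
        · have hlα := hmem σ ⟨j, hj⟩ l hl
          exact h2 ⟨l, hlα⟩ ((hsame σ ⟨j, hj⟩ ⟨l, hlα⟩).1 hl)
      · rintro ⟨hj, h1, h2⟩
        have hjα := Finset.mem_of_mem_erase hj
        refine ⟨hjα, fun h => h1 ((hsame σ ⟨i, hi⟩ ⟨j, hjα⟩).2 h), fun l hl => ?_⟩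
        exact h2 l ((hsame σ ⟨j, hjα⟩ l).2 hl)
    have hsort : (F.sort (· ≤ ·)).map Subtype.val =
        (otherMinima i (α.erase i) τ).sort (· ≤ ·) := by
      rw [← hmap, ← Finset.map_sort (r := (· ≤ ·))]
      · rfl
      · intro a _ b _
        rfl
    have hper : ∀ j : α, Function.minimalPeriod σ j = Function.minimalPeriod τ (j : Fin n) := by
      intro j
      apply minimalPeriod_congr
      intro m
      rw [hpow, Subtype.ext_iff]
    have hprod : ∀ j : α, cycleProd (principal (A.updateRow i u) α) σ j =
        cycleProd (A.updateRow i u) τ j := by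
      intro j
      apply cycleProd_congr (hper j)
      intro m
      rw [hpow, hpow]
      rfl
    have hcardF : F.card = (otherMinima i (α.erase i) τ).card := by
      rw [← hmap, Finset.card_map]
    have hle : F.card + 1 ≤ α.card := by
      have h1 := Finset.card_le_card (fun j hj => (mem_otherMinima.1 hj).1 :
        otherMinima i (α.erase i) τ ⊆ α.erase i)
      rw [Finset.card_erase_of_mem hi] at h1
      have : 0 < α.card := Finset.card_pos.2 ⟨i, hi⟩
      omega
    have hsign : (-1 : ℍ[ℝ]) ^ (Fintype.card α - (cycleHeads σ ⟨i, hi⟩).length) =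
        (-1) ^ ((α.erase i).card + (otherMinima i (α.erase i) τ).card) := by
      rw [hheads, List.length_cons, Finset.length_sort, Fintype.card_coe, ← hcardF,
        Finset.card_erase_of_mem hi]
      have : α.card - 1 + F.card = (α.card - (F.card + 1)) + 2 * F.card := by omega
      rw [this, pow_add, pow_mul, neg_one_sq, one_pow, mul_one]
    rw [hsign, hheads, List.map_cons, List.prod_cons, hprod]
    congr 2
    unfold cycleProds
    rw [← hsort, List.map_map]
    congr 1
    apply List.map_congr_left
    intro j hj
    rw [hprod]
    apply cycleProd_updateRow_of_not_sameCycle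
    rw [Finset.mem_sort, hF, Finset.mem_filter] at hj
    exact fun h => hj.2.1 ((hsame σ ⟨i, hi⟩ j).1 h)

theorem hdet_principal {n : ℕ} (A : Matrix (Fin n) (Fin n) ℍ[ℝ]) (α : Finset (Fin n)) :
    hdet (principal A α) = fullDet A α := by
  unfold hdet
  split_ifs with h
  · set m := Finset.univ.min' h with hm
    have h1 := rdet_principal_updateRow A (A m) m.2
    rw [Matrix.updateRow_eq_self] at h1
    rw [fullDet_eq_rowDet_of_least A m.2, ← h1]
    intro x hx
    exact Finset.min'_le (Finset.univ : Finset α) (⟨x, hx⟩ : α) (Finset.mem_univ _)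
  · have : α = ∅ := by
      rw [Finset.not_nonempty_iff_eq_empty, Finset.univ_eq_attach, Finset.attach_eq_empty_iff] at h
      exact h
    rw [this, fullDet_empty]

end Expansion

/-! ### Sums over subsets -/

section SubsetSums

variable {ι M : Type*} [DecidableEq ι] [AddCommMonoid M]

theorem sum_powerset_sum_erase (T : Finset ι) (f : ι → Finset ι → M) :
    ∑ V ∈ T.powerset, ∑ c ∈ V, f c (V.erase c) =
      ∑ c ∈ T, ∑ W ∈ (T.erase c).powerset, f c W := by
  rw [Finset.sum_sigma', Finset.sum_sigma']
  refine Finset.sum_bij' (fun x _ => ⟨x.2, x.1.erase x.2⟩) (fun y _ => ⟨insert y.1 y.2, y.1⟩)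
    ?_ ?_ ?_ ?_ ?_
  · rintro ⟨V, c⟩ h
    simp only [Finset.mem_sigma, Finset.mem_powerset] at h ⊢
    exact ⟨h.1 h.2, Finset.erase_subset_erase c h.1⟩
  · rintro ⟨c, W⟩ h
    simp only [Finset.mem_sigma, Finset.mem_powerset] at h ⊢
    exact ⟨Finset.insert_subset h.1 (h.2.trans (Finset.erase_subset _ _)),
      Finset.mem_insert_self _ _⟩
  · rintro ⟨V, c⟩ h
    simp only [Finset.mem_sigma] at h
    simp [Finset.insert_erase h.2]
  · rintro ⟨c, W⟩ h
    simp only [Finset.mem_sigma, Finset.mem_powerset] at h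
    have : c ∉ W := fun h' => by simpa using h.2 h'
    simp [Finset.erase_insert this]
  · rintro ⟨V, c⟩ _
    rfl

theorem sum_powersetCard_sum_erase (T : Finset ι) (m : ℕ) (f : ι → Finset ι → M) :
    ∑ V ∈ T.powersetCard (m + 1), ∑ c ∈ V, f c (V.erase c) =
      ∑ c ∈ T, ∑ W ∈ (T.erase c).powersetCard m, f c W := by
  rw [Finset.sum_sigma', Finset.sum_sigma']
  refine Finset.sum_bij' (fun x _ => ⟨x.2, x.1.erase x.2⟩) (fun y _ => ⟨insert y.1 y.2, y.1⟩)
    ?_ ?_ ?_ ?_ ?_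
  · rintro ⟨V, c⟩ h
    simp only [Finset.mem_sigma, Finset.mem_powersetCard] at h ⊢
    refine ⟨h.1.1 h.2, Finset.erase_subset_erase c h.1.1, ?_⟩
    rw [Finset.card_erase_of_mem h.2, h.1.2, Nat.add_sub_cancel]
  · rintro ⟨c, W⟩ h
    simp only [Finset.mem_sigma, Finset.mem_powersetCard] at h ⊢
    have : c ∉ W := fun h' => by simpa using h.2.1 h'
    exact ⟨⟨Finset.insert_subset h.1 (h.2.1.trans (Finset.erase_subset _ _)),
      by rw [Finset.card_insert_of_notMem this, h.2.2]⟩, Finset.mem_insert_self _ _⟩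
  · rintro ⟨V, c⟩ h
    simp only [Finset.mem_sigma] at h
    simp [Finset.insert_erase h.2]
  · rintro ⟨c, W⟩ h
    simp only [Finset.mem_sigma, Finset.mem_powersetCard] at h
    have : c ∉ W := fun h' => by simpa using h.2.1 h'
    simp [Finset.erase_insert this]
  · rintro ⟨V, c⟩ _
    rfl

theorem sum_powerset_sum_sdiff (T : Finset ι) (f : Finset ι → Finset ι → M) :
    ∑ V ∈ T.powerset, ∑ U ∈ V.powerset, f U (V \ U) =
      ∑ U ∈ T.powerset, ∑ W ∈ (T \ U).powerset, f U W := by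
  rw [Finset.sum_sigma', Finset.sum_sigma']
  refine Finset.sum_bij' (fun x _ => ⟨x.2, x.1 \ x.2⟩) (fun y _ => ⟨y.1 ∪ y.2, y.1⟩)
    ?_ ?_ ?_ ?_ ?_
  · rintro ⟨V, U⟩ h
    simp only [Finset.mem_sigma, Finset.mem_powerset] at h ⊢
    exact ⟨h.2.trans h.1, Finset.sdiff_subset_sdiff h.1 le_rfl⟩
  · rintro ⟨U, W⟩ h
    simp only [Finset.mem_sigma, Finset.mem_powerset] at h ⊢
    exact ⟨Finset.union_subset h.1 (h.2.trans Finset.sdiff_subset), Finset.subset_union_left⟩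
  · rintro ⟨V, U⟩ h
    simp only [Finset.mem_sigma, Finset.mem_powerset] at h
    simp [Finset.union_eq_right.2 h.2]
  · rintro ⟨U, W⟩ h
    simp only [Finset.mem_sigma, Finset.mem_powerset, Finset.subset_sdiff] at h
    simp [Finset.union_sdiff_cancel_left h.2.2.symm]
  · rintro ⟨V, U⟩ _
    rfl

theorem sum_powerset_sdiff_comm (T : Finset ι) (f : Finset ι → Finset ι → M) :
    ∑ V ∈ T.powerset, ∑ W ∈ (T \ V).powerset, f V W =
      ∑ W ∈ T.powerset, ∑ V ∈ (T \ W).powerset, f V W := by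
  apply Finset.sum_comm'
  intro V W
  simp only [Finset.mem_powerset, Finset.subset_sdiff]
  constructor
  · rintro ⟨h1, h2, h3⟩
    exact ⟨⟨h1, h3.symm⟩, h2⟩
  · rintro ⟨⟨h1, h3⟩, h2⟩
    exact ⟨h1, h2, h3.symm⟩

theorem sum_powerset_compl (T : Finset ι) (f : Finset ι → Finset ι → M) :
    ∑ V ∈ T.powerset, f V (T \ V) = ∑ V ∈ T.powerset, f (T \ V) V := by
  refine Finset.sum_bij' (fun V _ => T \ V) (fun V _ => T \ V) ?_ ?_ ?_ ?_ ?_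
  · intro V _
    simp
  · intro V _
    simp
  · intro V hV
    exact Finset.sdiff_sdiff_eq_self (Finset.mem_powerset.1 hV)
  · intro V hV
    exact Finset.sdiff_sdiff_eq_self (Finset.mem_powerset.1 hV)
  · intro V hV
    rw [Finset.sdiff_sdiff_eq_self (Finset.mem_powerset.1 hV)]

theorem sum_sum_erase_comm (T : Finset ι) (f : ι → ι → M) :
    ∑ c ∈ T, ∑ a ∈ T.erase c, f c a = ∑ a ∈ T, ∑ c ∈ T.erase a, f c a := by
  apply Finset.sum_comm'
  intro c a
  simp only [Finset.mem_erase]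
  constructor
  · rintro ⟨h1, h2, h3⟩
    exact ⟨⟨h2.symm, h1⟩, h3⟩
  · rintro ⟨⟨h2, h1⟩, h3⟩
    exact ⟨h1, h2.symm, h3⟩

end SubsetSums

section SetDifferences

variable {ι : Type*} [DecidableEq ι]

theorem insert_sdiff_insert_of_notMem {T V : Finset ι} {j : ι} (hj : j ∉ T) :
    insert j T \ insert j V = T \ V := by
  rw [Finset.insert_sdiff_insert, Finset.sdiff_insert_of_notMem hj]

theorem erase_sdiff_erase_of_mem {T U : Finset ι} {c : ι} (hc : c ∈ U) :
    T.erase c \ U.erase c = T \ U := by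
  ext z
  simp only [Finset.mem_sdiff, Finset.mem_erase]
  constructor
  · rintro ⟨⟨h1, h2⟩, h3⟩
    exact ⟨h2, fun h => h3 ⟨h1, h⟩⟩
  · rintro ⟨h1, h2⟩
    exact ⟨⟨fun h => h2 (h ▸ hc), h1⟩, fun h => h2 h.2⟩

end SetDifferences

/-! ### Signed sums over paths -/

section Paths

variable {ι : Type} [LinearOrder ι]

/-- The sum of `(-1) ^ |V| * A x c₁ * A c₁ c₂ * ⋯ * A cₘ y` over all enumerations `c₁, …, cₘ` of
`V`: a signed sum over the paths from `x` to `y` whose inner vertices are exactly the elements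
of `V`. -/
noncomputable def pathSum (A : Matrix ι ι ℍ[ℝ]) (V : Finset ι) (x y : ι) : ℍ[ℝ] :=
  (if V = ∅ then A x y else 0) - ∑ c ∈ V.attach, A x c * pathSum A (V.erase c) c y
termination_by V.card
decreasing_by exact Finset.card_erase_lt_of_mem c.2

theorem pathSum_eq (A : Matrix ι ι ℍ[ℝ]) (V : Finset ι) (x y : ι) :
    pathSum A V x y =
      (if V = ∅ then A x y else 0) - ∑ c ∈ V, A x c * pathSum A (V.erase c) c y := by
  rw [pathSum, Finset.sum_attach V (fun c => A x c * pathSum A (V.erase c) c y)]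

/-- The recursion for `pathSum` that splits off the last step instead of the first one. -/
theorem pathSum_eq_right (A : Matrix ι ι ℍ[ℝ]) (V : Finset ι) (x y : ι) :
    pathSum A V x y =
      (if V = ∅ then A x y else 0) - ∑ c ∈ V, pathSum A (V.erase c) x c * A c y := by
  induction V using Finset.strongInduction generalizing x with
  | H V ih =>
    rw [pathSum_eq]
    congr 1
    have h1 : ∀ c ∈ V, A x c * pathSum A (V.erase c) c y =
        A x c * (if V.erase c = ∅ then A c y else 0) -
          ∑ a ∈ V.erase c, A x c * (pathSum A ((V.erase c).erase a) c a * A a y) := by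
      intro c hc
      rw [ih _ (Finset.erase_ssubset hc), mul_sub, Finset.mul_sum]
    have h2 : ∀ a ∈ V, pathSum A (V.erase a) x a * A a y =
        (if V.erase a = ∅ then A x a else 0) * A a y -
          ∑ c ∈ V.erase a, A x c * (pathSum A ((V.erase c).erase a) c a * A a y) := by
      intro a _
      rw [pathSum_eq A (V.erase a), sub_mul, Finset.sum_mul]
      congr 1
      refine Finset.sum_congr rfl fun c _ => ?_
      rw [Finset.erase_right_comm, mul_assoc]
    rw [Finset.sum_congr rfl h1, Finset.sum_congr rfl h2, Finset.sum_sub_distrib,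
      Finset.sum_sub_distrib, sum_sum_erase_comm]
    congr 1
    refine Finset.sum_congr rfl fun c _ => ?_
    split_ifs <;> simp

/-- Conjugation reverses the paths. -/
theorem star_pathSum {H : Matrix ι ι ℍ[ℝ]} (hH : H.IsHermitian) (V : Finset ι) (x y : ι) :
    star (pathSum H V x y) = pathSum H V y x := by
  induction V using Finset.strongInduction generalizing x with
  | H V ih =>
    rw [pathSum_eq, pathSum_eq_right H V y x, star_sub, star_sum]
    congr 1
    · split_ifs
      · exact hH.apply y x
      · exact star_zero _
    · refine Finset.sum_congr rfl fun c hc => ?_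
      rw [star_mul, ih _ (Finset.erase_ssubset hc), hH.apply]

/-- Every path through `j` is cut at `j`. The sign comes from `j` itself, which is an inner vertex
of the whole path but of neither half. -/
theorem pathSum_insert (A : Matrix ι ι ℍ[ℝ]) {V : Finset ι} {j : ι} (hj : j ∉ V) (x y : ι) :
    pathSum A (insert j V) x y =
      -∑ U ∈ V.powerset, pathSum A U x j * pathSum A (V \ U) j y := by
  induction V using Finset.strongInduction generalizing x with
  | H V ih =>
    have h1 : ∀ c ∈ V, A x c * pathSum A ((insert j V).erase c) c y =
        -∑ W ∈ (V.erase c).powerset,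
          A x c * (pathSum A W c j * pathSum A ((V.erase c) \ W) j y) := by
      intro c hc
      have hcj : c ≠ j := fun h => hj (h ▸ hc)
      rw [Finset.erase_insert_of_ne hcj.symm, ih _ (Finset.erase_ssubset hc)
        (fun h => hj (Finset.mem_of_mem_erase h)), mul_neg, Finset.mul_sum]
    have h2 : ∀ U ∈ V.powerset, pathSum A U x j * pathSum A (V \ U) j y =
        (if U = ∅ then A x j * pathSum A V j y else 0) -
          ∑ c ∈ U, A x c * (pathSum A (U.erase c) c j *
            pathSum A ((V.erase c) \ (U.erase c)) j y) := by
      intro U _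
      rw [pathSum_eq A U, sub_mul, Finset.sum_mul]
      congr 1
      · split_ifs with h
        · rw [h, Finset.sdiff_empty]
        · rw [zero_mul]
      · refine Finset.sum_congr rfl fun c hc => ?_
        rw [erase_sdiff_erase_of_mem hc, mul_assoc]
    rw [pathSum_eq, if_neg (Finset.insert_ne_empty _ _), zero_sub, Finset.sum_insert hj,
      Finset.erase_insert hj, Finset.sum_congr rfl h1, Finset.sum_congr rfl h2,
      Finset.sum_sub_distrib,
      sum_powerset_sum_erase V (fun c W => A x c * (pathSum A W c j *
        pathSum A ((V.erase c) \ W) j y)), Finset.sum_neg_distrib,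
      Finset.sum_ite_eq' V.powerset ∅, if_pos (Finset.empty_mem_powerset V)]
    abel

/-- Self-adjoint quaternions are real; being real is expressed by membership in the
subalgebra `⊥`. -/
theorem mem_bot_of_star_eq {q : ℍ[ℝ]} (h : star q = q) : q ∈ (⊥ : Subalgebra ℝ ℍ[ℝ]) := by
  rw [Quaternion.star_eq_self] at h
  exact Algebra.mem_bot.2 ⟨q.re, h.symm⟩

theorem commute_of_mem_bot {q : ℍ[ℝ]} (h : q ∈ (⊥ : Subalgebra ℝ ℍ[ℝ])) (x : ℍ[ℝ]) :
    q * x = x * q := by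
  obtain ⟨a, rfl⟩ := Algebra.mem_bot.1 h
  exact Algebra.commutes a x

theorem pathSum_self_mem_bot {H : Matrix ι ι ℍ[ℝ]} (hH : H.IsHermitian) (V : Finset ι) (x : ι) :
    pathSum H V x x ∈ (⊥ : Subalgebra ℝ ℍ[ℝ]) :=
  mem_bot_of_star_eq (star_pathSum hH V x x)

theorem re_mul_comm (a b : ℍ[ℝ]) : (a * b).re = (b * a).re := by
  simp only [Quaternion.re_mul]
  ring

theorem re_sum {κ : Type*} (s : Finset κ) (f : κ → ℍ[ℝ]) :
    (∑ i ∈ s, f i).re = ∑ i ∈ s, (f i).re :=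
  map_sum (⟨⟨fun q : ℍ[ℝ] => q.re, rfl⟩, fun _ _ => rfl⟩ : ℍ[ℝ] →+ ℝ) f s

/-- The signed sum over the cyclic arrangements of a set does not depend on the point at which
the cycles are cut open. -/
theorem pathSum_insert_self_comm {H : Matrix ι ι ℍ[ℝ]} (hH : H.IsHermitian) {V : Finset ι}
    {i j : ι} (hi : i ∉ V) (hj : j ∉ V) :
    pathSum H (insert j V) i i = pathSum H (insert i V) j j := by
  rw [(Quaternion.star_eq_self).1 (star_pathSum hH (insert j V) i i),
    (Quaternion.star_eq_self).1 (star_pathSum hH (insert i V) j j),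
    pathSum_insert H hj, pathSum_insert H hi, Quaternion.re_neg, Quaternion.re_neg, re_sum, re_sum,
    sum_powerset_compl V (fun U W => (pathSum H U i j * pathSum H W j i).re)]
  congr 2
  exact Finset.sum_congr rfl fun U _ => re_mul_comm _ _

end Paths

/-! ### Row determinants of Hermitian matrices -/

section HermitianDet

variable {ι : Type} [Fintype ι] [LinearOrder ι]

/-- `V` is the set of vertices other than `i` on the cycle through `i`. -/
theorem rowDet_eq_sum_pathSum (A : Matrix ι ι ℍ[ℝ]) (x : ι) {i : ι} {T : Finset ι} (hi : i ∉ T) :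
    rowDet A (A x) i T = ∑ V ∈ T.powerset, pathSum A V x i * fullDet A (T \ V) := by
  induction T using Finset.strongInduction generalizing x with
  | H T ih =>
    have h1 : ∀ c ∈ T, A x c * rowDet A (A c) i (T.erase c) =
        ∑ W ∈ (T.erase c).powerset, A x c * (pathSum A W c i * fullDet A ((T.erase c) \ W)) := by
      intro c hc
      rw [ih _ (Finset.erase_ssubset hc) c (fun h => hi (Finset.mem_of_mem_erase h)),
        Finset.mul_sum]
    have h2 : ∀ U ∈ T.powerset, pathSum A U x i * fullDet A (T \ U) =
        (if U = ∅ then A x i * fullDet A T else 0) -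
          ∑ c ∈ U, A x c * (pathSum A (U.erase c) c i *
            fullDet A ((T.erase c) \ (U.erase c))) := by
      intro U _
      rw [pathSum_eq A U, sub_mul, Finset.sum_mul]
      congr 1
      · split_ifs with h
        · rw [h, Finset.sdiff_empty]
        · rw [zero_mul]
      · refine Finset.sum_congr rfl fun c hc => ?_
        rw [erase_sdiff_erase_of_mem hc, mul_assoc]
    rw [rowDet_expand A _ hi, Finset.sum_congr rfl h1, Finset.sum_congr rfl h2,
      Finset.sum_sub_distrib,
      sum_powerset_sum_erase T (fun c W => A x c * (pathSum A W c i *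
        fullDet A ((T.erase c) \ W))),
      Finset.sum_ite_eq' T.powerset ∅, if_pos (Finset.empty_mem_powerset T)]

/-- For a Hermitian matrix, all row determinants of a principal submatrix agree.
The proof is by induction on the index set: in the expansion along the cycle through `i`, the cycles
that miss `j` leave a factor that can be expanded along the cycle through `j`, and the cycles that
contain `j` can be cut at `j` instead of `i`. Both parts are then symmetric in `i` and `j`. -/
theorem fullDet_insert {H : Matrix ι ι ℍ[ℝ]} (hH : H.IsHermitian) {T : Finset ι} {j : ι}
    (hj : j ∉ T) : fullDet H (insert j T) = rowDet H (H j) j T := by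
  suffices key : ∀ S : Finset ι, ∀ j ∈ S, fullDet H S = rowDet H (H j) j (S.erase j) by
    have := key (insert j T) j (Finset.mem_insert_self _ _)
    rwa [Finset.erase_insert hj] at this
  intro S
  induction S using Finset.strongInduction with
  | H S ih =>
    -- Splitting the cycle through `i` according to whether it passes through `j`.
    have expand : ∀ i j : ι, ∀ T : Finset ι, i ∉ T → j ∉ T → i ≠ j → insert i (insert j T) = S →
        rowDet H (H i) i (insert j T) =
          ∑ V ∈ T.powerset, ∑ W ∈ (T \ V).powerset,
            pathSum H V i i * (pathSum H W j j * fullDet H ((T \ V) \ W)) +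
          ∑ V ∈ T.powerset, pathSum H (insert j V) i i * fullDet H (T \ V) := by
      intro i j T hi hj hij hS
      have hi' : i ∉ insert j T := by simp [hi, hij]
      rw [rowDet_eq_sum_pathSum H i hi', Finset.sum_powerset_insert hj]
      congr 1
      · refine Finset.sum_congr rfl fun V hV => ?_
        have hjV : j ∉ V := fun h => hj (Finset.mem_powerset.1 hV h)
        have hjT : j ∉ T \ V := fun h => hj (Finset.mem_sdiff.1 h).1
        have hsub : insert j (T \ V) ⊂ S := by
          rw [← hS]
          refine (Finset.ssubset_insert hi').trans_le' ?_
          exact Finset.insert_subset_insert _ Finset.sdiff_subset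
        rw [Finset.insert_sdiff_of_notMem _ hjV, ih _ hsub j (Finset.mem_insert_self _ _),
          Finset.erase_insert hjT, rowDet_eq_sum_pathSum H j hjT, Finset.mul_sum]
      · refine Finset.sum_congr rfl fun V _ => ?_
        rw [insert_sdiff_insert_of_notMem hj]
    have symm : ∀ i j : ι, i ∈ S → j ∈ S → i ≠ j →
        rowDet H (H i) i (S.erase i) = rowDet H (H j) j (S.erase j) := by
      intro i j hiS hjS hij
      set T := (S.erase i).erase j with hT
      have hi : i ∉ T := by simp [hT]
      have hj : j ∉ T := by simp [hT]
      have e1 : insert j T = S.erase i := Finset.insert_erase (by simp [hjS, hij.symm])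
      have e2 : insert i T = S.erase j := by
        rw [hT, Finset.erase_right_comm]
        exact Finset.insert_erase (by simp [hiS, hij])
      rw [← e1, ← e2, expand i j T hi hj hij (by rw [e1, Finset.insert_erase hiS]),
        expand j i T hj hi hij.symm (by rw [e2, Finset.insert_erase hjS]),
        sum_powerset_sdiff_comm]
      congr 1
      · refine Finset.sum_congr rfl fun V _ => Finset.sum_congr rfl fun W _ => ?_
        rw [← mul_assoc, ← mul_assoc, commute_of_mem_bot (pathSum_self_mem_bot hH V j),
          sdiff_right_comm]
      · refine Finset.sum_congr rfl fun V hV => ?_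
        have hV' := Finset.mem_powerset.1 hV
        rw [pathSum_insert_self_comm hH (fun h => hi (hV' h)) (fun h => hj (hV' h))]
    intro j hj
    have hne : S.Nonempty := ⟨j, hj⟩
    rw [fullDet_eq_rowDet_of_least H (S.min'_mem hne) (fun x hx => S.min'_le x hx)]
    rcases eq_or_ne (S.min' hne) j with h | h
    · rw [h]
    · exact symm _ _ (S.min'_mem hne) hj h

theorem fullDet_mem_bot {H : Matrix ι ι ℍ[ℝ]} (hH : H.IsHermitian) (S : Finset ι) :
    fullDet H S ∈ (⊥ : Subalgebra ℝ ℍ[ℝ]) := by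
  induction S using Finset.strongInduction with
  | H S ih =>
    rcases S.eq_empty_or_nonempty with rfl | ⟨j, hj⟩
    · rw [fullDet_empty]
      exact one_mem _
    · have h := fullDet_insert hH (Finset.notMem_erase j S)
      rw [Finset.insert_erase hj, rowDet_eq_sum_pathSum H j (Finset.notMem_erase j S)] at h
      rw [h]
      refine sum_mem fun V _ => mul_mem (pathSum_self_mem_bot hH V j) (ih _ ?_)
      exact (Finset.erase_ssubset hj).trans_le' Finset.sdiff_subset

/-- A row determinant of a Hermitian matrix vanishes once row `i` is replaced by another row.
If the cycle through `i` avoids `j`, then the cycle through `j` contributes a real factor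
`pathSum H W j j`; if it passes through `j`, the path `j → ⋯ → j → ⋯ → i` is cut at `j`, and its
first part is the same real factor with the opposite sign. The two kinds of terms cancel. -/
theorem rowDet_eq_zero {H : Matrix ι ι ℍ[ℝ]} (hH : H.IsHermitian) {S : Finset ι} {i j : ι}
    (hi : i ∉ S) (hj : j ∈ S) : rowDet H (H j) i S = 0 := by
  obtain ⟨T, hjT, rfl⟩ : ∃ T, j ∉ T ∧ insert j T = S :=
    ⟨S.erase j, Finset.notMem_erase j S, Finset.insert_erase hj⟩
  have h1 : ∀ V ∈ T.powerset, pathSum H V j i * fullDet H (insert j T \ V) =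
      ∑ W ∈ (T \ V).powerset, pathSum H V j i * (pathSum H W j j * fullDet H ((T \ V) \ W)) := by
    intro V hV
    have hjV : j ∉ V := fun h => hjT (Finset.mem_powerset.1 hV h)
    have hjTV : j ∉ T \ V := fun h => hjT (Finset.mem_sdiff.1 h).1
    rw [Finset.insert_sdiff_of_notMem _ hjV, fullDet_insert hH hjTV,
      rowDet_eq_sum_pathSum H j hjTV, Finset.mul_sum]
  have h2 : ∀ V ∈ T.powerset, pathSum H (insert j V) j i * fullDet H (insert j T \ insert j V) =
      -∑ U ∈ V.powerset, pathSum H U j j * (pathSum H (V \ U) j i *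
        fullDet H ((T \ U) \ (V \ U))) := by
    intro V hV
    have hjV : j ∉ V := fun h => hjT (Finset.mem_powerset.1 hV h)
    rw [insert_sdiff_insert_of_notMem hjT, pathSum_insert H hjV, neg_mul, Finset.sum_mul]
    congr 1
    refine Finset.sum_congr rfl fun U hU => ?_
    have : (T \ U) \ (V \ U) = T \ V := by
      ext z
      simp only [Finset.mem_sdiff]
      have hUV : z ∈ U → z ∈ V := fun h => Finset.mem_powerset.1 hU h
      tauto
    rw [this, mul_assoc]
  rw [rowDet_eq_sum_pathSum H j hi, Finset.sum_powerset_insert hjT, Finset.sum_congr rfl h1,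
    Finset.sum_congr rfl h2, Finset.sum_neg_distrib,
    sum_powerset_sum_sdiff T (fun U W => pathSum H U j j * (pathSum H W j i *
        fullDet H ((T \ U) \ W))), sum_powerset_sdiff_comm, add_neg_eq_zero]
  refine Finset.sum_congr rfl fun V _ => Finset.sum_congr rfl fun W _ => ?_
  rw [← mul_assoc, ← mul_assoc, commute_of_mem_bot (pathSum_self_mem_bot hH V j),
    sdiff_right_comm]

end HermitianDet

/-! ### Rank and trace of quaternion matrices -/

section Rank

variable {n : ℕ}

theorem qrank_eq_finrank_range (A : Matrix (Fin n) (Fin n) ℍ[ℝ]) :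
    qrank A = Module.finrank ℍ[ℝ] (LinearMap.range A.vecMulLinear) := by
  rw [range_vecMulLinear]
  rfl

theorem range_vecMulLinear_mul_le (X A : Matrix (Fin n) (Fin n) ℍ[ℝ]) :
    LinearMap.range (X * A).vecMulLinear ≤ LinearMap.range A.vecMulLinear := by
  rintro _ ⟨x, rfl⟩
  exact ⟨x ᵥ* X, by simp [Matrix.vecMul_vecMul]⟩

theorem qrank_eq_of_mul_eq {A B X Y : Matrix (Fin n) (Fin n) ℍ[ℝ]} (h1 : X * A = B)
    (h2 : Y * B = A) : qrank A = qrank B := by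
  rw [qrank_eq_finrank_range, qrank_eq_finrank_range]
  have : LinearMap.range A.vecMulLinear = LinearMap.range B.vecMulLinear := by
    apply le_antisymm
    · rw [← h2]
      exact range_vecMulLinear_mul_le Y B
    · rw [← h1]
      exact range_vecMulLinear_mul_le X A
  rw [this]

theorem eq_zero_of_dotProduct_star_self {y : Fin n → ℍ[ℝ]} (h : y ⬝ᵥ star y = 0) : y = 0 := by
  have h1 : ∑ i, Quaternion.normSq (y i) = 0 := by
    have h2 := congrArg (fun q : ℍ[ℝ] => q.re) h
    simp only [dotProduct, re_sum, Pi.star_apply, Quaternion.self_mul_star, Quaternion.re_coe,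
      Quaternion.re_zero] at h2
    exact h2
  funext i
  rw [Finset.sum_eq_zero_iff_of_nonneg (fun _ _ => Quaternion.normSq_nonneg)] at h1
  exact Quaternion.normSq_eq_zero.1 (h1 i (Finset.mem_univ i))

theorem vecMul_eq_zero_of_mul_conjTranspose {M : Matrix (Fin n) (Fin n) ℍ[ℝ]} {x : Fin n → ℍ[ℝ]}
    (h : x ᵥ* (M * Mᴴ) = 0) : x ᵥ* M = 0 := by
  apply eq_zero_of_dotProduct_star_self
  rw [Matrix.star_vecMul, Matrix.dotProduct_mulVec, Matrix.vecMul_vecMul, h, zero_dotProduct]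

/-- A factor `Mᴴ` on the right of `Y * M` can be cancelled, because `y ⬝ᵥ star y` vanishes only for
`y = 0`. -/
theorem mul_eq_zero_of_mul_conjTranspose {M Y : Matrix (Fin n) (Fin n) ℍ[ℝ]}
    (h : Y * (M * Mᴴ) = 0) : Y * M = 0 := by
  funext i
  rw [Matrix.mul_apply_eq_vecMul]
  apply vecMul_eq_zero_of_mul_conjTranspose
  rw [← Matrix.mul_apply_eq_vecMul, h]
  rfl

theorem qrank_mul_conjTranspose_self (M : Matrix (Fin n) (Fin n) ℍ[ℝ]) :
    qrank (M * Mᴴ) = qrank M := by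
  have hker : LinearMap.ker (M * Mᴴ).vecMulLinear = LinearMap.ker M.vecMulLinear := by
    ext x
    rw [LinearMap.mem_ker, LinearMap.mem_ker, Matrix.vecMulLinear_apply, Matrix.vecMulLinear_apply]
    refine ⟨vecMul_eq_zero_of_mul_conjTranspose, fun h => ?_⟩
    rw [← Matrix.vecMul_vecMul, h, Matrix.zero_vecMul]
  have h1 := LinearMap.finrank_range_add_finrank_ker (M * Mᴴ).vecMulLinear
  have h2 := LinearMap.finrank_range_add_finrank_ker M.vecMulLinear
  rw [hker] at h1
  rw [qrank_eq_finrank_range, qrank_eq_finrank_range]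
  omega

theorem mul_eq_zero_of_mul_pow {H Y : Matrix (Fin n) (Fin n) ℍ[ℝ]} (hH : H.IsHermitian) (j : ℕ)
    (h : Y * H ^ j = 0) : Y * H = 0 := by
  induction j with
  | zero => rw [pow_zero, mul_one] at h; rw [h, zero_mul]
  | succ j ih =>
    rcases Nat.eq_zero_or_pos j with rfl | hj
    · simpa using h
    · obtain ⟨l, rfl⟩ := Nat.exists_eq_succ_of_ne_zero hj.ne'
      apply ih
      rw [Nat.succ_eq_add_one, pow_succ, ← mul_assoc]
      apply mul_eq_zero_of_mul_conjTranspose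
      rw [hH.eq, ← h, pow_succ, pow_succ]
      simp only [mul_assoc]

/-- The real trace of an idempotent quaternion matrix is its rank: for a factorization
`E = P * Q` through a basis of the row space one has `Q * P = 1`, and the real part of the trace is
cyclic although the trace itself is not. -/
theorem re_trace_eq_qrank_of_idempotent {E : Matrix (Fin n) (Fin n) ℍ[ℝ]} (hE : E * E = E) :
    (∑ i, E i i).re = qrank E := by
  let V := Submodule.span ℍ[ℝ] (Set.range (fun i : Fin n => E i))
  let v := Module.finBasis ℍ[ℝ] V
  let Q : Matrix (Fin (Module.finrank ℍ[ℝ] V)) (Fin n) ℍ[ℝ] := fun j => (v j : Fin n → ℍ[ℝ])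
  let P : Matrix (Fin n) (Fin (Module.finrank ℍ[ℝ] V)) ℍ[ℝ] :=
    fun i j => v.repr ⟨E i, Submodule.subset_span ⟨i, rfl⟩⟩ j
  have hPQ : P * Q = E := by
    funext i
    rw [Matrix.mul_apply_eq_vecMul, Matrix.vecMul_eq_sum]
    have h := congrArg Subtype.val (v.sum_repr ⟨E i, Submodule.subset_span ⟨i, rfl⟩⟩)
    rw [Submodule.coe_sum] at h
    exact h
  have hQE : Q * E = Q := by
    funext j
    rw [Matrix.mul_apply_eq_vecMul]
    have hj : (v j : Fin n → ℍ[ℝ]) ∈ LinearMap.range E.vecMulLinear := by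
      rw [range_vecMulLinear]
      exact (v j).2
    obtain ⟨x, hx⟩ := hj
    have hx' : x ᵥ* E = Q j := hx
    rw [← hx', Matrix.vecMul_vecMul, hE]
  have hinj : ∀ c : Fin (Module.finrank ℍ[ℝ] V) → ℍ[ℝ], c ᵥ* Q = 0 → c = 0 := by
    intro c hc
    have hli := Fintype.linearIndependent_iff.1 v.linearIndependent c
    funext j
    apply hli
    apply Subtype.ext
    rw [Matrix.vecMul_eq_sum] at hc
    simpa [Q] using hc
  have hQP : Q * P = 1 := by
    have h0 : (Q * P - 1) * Q = 0 := by
      rw [Matrix.sub_mul, Matrix.mul_assoc, hPQ, hQE, Matrix.one_mul, sub_self]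
    rw [← sub_eq_zero]
    funext j
    exact hinj _ ((Matrix.mul_apply_eq_vecMul _ _ j).symm.trans (congrFun h0 j))
  calc (∑ i, E i i).re = ∑ i, ∑ j, (P i j * Q j i).re := by
        rw [← hPQ, re_sum]
        refine Finset.sum_congr rfl fun i _ => ?_
        rw [Matrix.mul_apply, re_sum]
    _ = ∑ j, ∑ i, (Q j i * P i j).re := by
        rw [Finset.sum_comm]
        exact Finset.sum_congr rfl fun j _ => Finset.sum_congr rfl fun i _ => re_mul_comm _ _
    _ = ∑ j, ((Q * P) j j).re := by
        refine Finset.sum_congr rfl fun j _ => ?_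
        rw [Matrix.mul_apply, re_sum]
    _ = qrank E := by
        rw [hQP]
        simp [qrank, V]

end Rank

/-! ### Adjugates built from the principal minors of a fixed order -/

section Adjugate

variable {n : ℕ}

theorem minorSum_eq (m : ℕ) (A : Matrix (Fin n) (Fin n) ℍ[ℝ]) :
    minorSum m A = ∑ S ∈ Finset.univ.powersetCard m, fullDet A S := by
  unfold minorSum
  simp only [hdet_principal]
  rw [Finset.sum_subtype (p := fun α : Finset (Fin n) => α.card = m)]
  intro S
  simp [Finset.mem_powersetCard]

theorem rdetSum_zero (A : Matrix (Fin n) (Fin n) ℍ[ℝ]) (i : Fin n) (c : Fin n → ℍ[ℝ]) :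
    rdetSum 0 A i c = 0 := by
  unfold rdetSum
  apply Finset.sum_eq_zero
  rintro ⟨α, h1, h2⟩ _
  rw [Finset.card_eq_zero] at h1
  simp [h1] at h2

theorem rdetSum_succ (m : ℕ) (A : Matrix (Fin n) (Fin n) ℍ[ℝ]) (i : Fin n) (c : Fin n → ℍ[ℝ]) :
    rdetSum (m + 1) A i c =
      ∑ T ∈ (Finset.univ.erase i).powersetCard m, rowDet A c i T := by
  unfold rdetSum
  simp only [rdet_principal_updateRow]
  have hT : ∀ T ∈ (Finset.univ.erase i).powersetCard m, i ∉ T := fun T hT h => by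
    simpa using (Finset.mem_powersetCard.1 hT).1 h
  refine Finset.sum_bij' (fun α _ => α.1.erase i)
    (fun T hT' => ⟨insert i T, by
      rw [Finset.card_insert_of_notMem (hT T hT'), (Finset.mem_powersetCard.1 hT').2],
      Finset.mem_insert_self _ _⟩) ?_ ?_ ?_ ?_ ?_
  · rintro ⟨α, h1, h2⟩ _
    refine Finset.mem_powersetCard.2 ⟨Finset.erase_subset_erase _ (Finset.subset_univ _), ?_⟩
    exact (Finset.card_erase_of_mem h2).trans (by rw [h1, Nat.add_sub_cancel])
  · intro T _
    exact Finset.mem_univ _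
  · rintro ⟨α, h1, h2⟩ _
    exact Subtype.ext (Finset.insert_erase h2)
  · intro T hT'
    exact Finset.erase_insert (hT T hT')
  · intro α _
    rfl

theorem rowDet_eq_sum_single (A : Matrix (Fin n) (Fin n) ℍ[ℝ]) (u : Fin n → ℍ[ℝ]) {i : Fin n}
    {T : Finset (Fin n)} (hi : i ∉ T) :
    rowDet A u i T = ∑ s, u s * rowDet A (Pi.single s 1) i T := by
  have h : ∀ s, u s * rowDet A (Pi.single s 1) i T =
      (if i = s then u s * fullDet A T else 0) -
        ∑ c ∈ T, (if c = s then u s * rowDet A (A c) i (T.erase c) else 0) := by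
    intro s
    rw [rowDet_expand A _ hi, mul_sub, Finset.mul_sum]
    simp only [Pi.single_apply, ite_mul, one_mul, zero_mul, mul_ite, mul_zero]
  rw [rowDet_expand A u hi, Finset.sum_congr rfl fun s _ => h s, Finset.sum_sub_distrib,
    Finset.sum_comm]
  simp

/-- The matrix of the linear map sending a row `c` to the row of the sums `rdetSum m A i c`. For
commuting entries it is the coefficient of `X ^ (n - m)` in the adjugate of `X + A`. -/
noncomputable def minorAdjugate (m : ℕ) (A : Matrix (Fin n) (Fin n) ℍ[ℝ]) :
    Matrix (Fin n) (Fin n) ℍ[ℝ] :=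
  fun s i => rdetSum m A i (Pi.single s 1)

theorem rdetSum_eq_vecMul (m : ℕ) (A : Matrix (Fin n) (Fin n) ℍ[ℝ]) (i : Fin n)
    (c : Fin n → ℍ[ℝ]) : rdetSum m A i c = (c ᵥ* minorAdjugate m A) i := by
  change _ = ∑ s, c s * rdetSum m A i (Pi.single s 1)
  cases m with
  | zero => simp [rdetSum_zero]
  | succ m =>
    simp only [rdetSum_succ, Finset.mul_sum]
    rw [Finset.sum_comm]
    refine Finset.sum_congr rfl fun T hT => rowDet_eq_sum_single A c fun h => ?_
    simpa using (Finset.mem_powersetCard.1 hT).1 h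

/-- In the expansion of `rdetSum (m + 1) H i c`, the terms with `c a` collect row determinants in
which row `i` is replaced by row `a`. These make up `rdetSum m H i (H a)`, since the missing ones
vanish by `rowDet_eq_zero`; for `a = i` they are the minors through `i`, by
`fullDet_insert`. -/
theorem rdetSum_recursion {H : Matrix (Fin n) (Fin n) ℍ[ℝ]} (hH : H.IsHermitian) (m : ℕ)
    (i : Fin n) (c : Fin n → ℍ[ℝ]) :
    rdetSum (m + 1) H i c + rdetSum m H i (c ᵥ* H) = c i * minorSum m H := by
  have hlin : rdetSum m H i (c ᵥ* H) = ∑ s, c s * rdetSum m H i (H s) := by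
    rw [rdetSum_eq_vecMul, Matrix.vecMul_vecMul]
    change ∑ s, c s * (H * minorAdjugate m H) s i = _
    refine Finset.sum_congr rfl fun s _ => ?_
    rw [rdetSum_eq_vecMul, ← Matrix.mul_apply_eq_vecMul]
  have hT : ∀ (m : ℕ), ∀ T ∈ (Finset.univ.erase i).powersetCard m, i ∉ T := fun m T hT h => by
    simpa using (Finset.mem_powersetCard.1 hT).1 h
  have hexp : rdetSum (m + 1) H i c =
      c i * ∑ T ∈ (Finset.univ.erase i).powersetCard m, fullDet H T -
        ∑ T ∈ (Finset.univ.erase i).powersetCard m,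
          ∑ a ∈ T, c a * rowDet H (H a) i (T.erase a) := by
    rw [rdetSum_succ, Finset.mul_sum, ← Finset.sum_sub_distrib]
    exact Finset.sum_congr rfl fun T h => rowDet_expand H c (hT m T h)
  rw [hlin, hexp, minorSum_eq]
  cases m with
  | zero => simp [rdetSum_zero]
  | succ m =>
    have hoff : ∀ a ∈ Finset.univ.erase i, c a * rdetSum (m + 1) H i (H a) =
        ∑ T ∈ ((Finset.univ.erase i).erase a).powersetCard m, c a * rowDet H (H a) i T := by
      intro a _
      rw [rdetSum_succ, Finset.mul_sum]
      symm
      apply Finset.sum_subset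
      · exact Finset.powersetCard_mono (Finset.erase_subset _ _)
      · intro T hT1 hT2
        have haT : a ∈ T := by
          by_contra h
          apply hT2
          rw [Finset.mem_powersetCard] at hT1 ⊢
          exact ⟨Finset.subset_erase.2 ⟨hT1.1, h⟩, hT1.2⟩
        rw [rowDet_eq_zero hH (hT m T hT1) haT, mul_zero]
    have hdiag : rdetSum (m + 1) H i (H i) =
        ∑ T ∈ (Finset.univ.erase i).powersetCard m, fullDet H (insert i T) := by
      rw [rdetSum_succ]
      exact Finset.sum_congr rfl fun T h => (fullDet_insert hH (hT m T h)).symm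
    have hminor : ∑ S ∈ (Finset.univ : Finset (Fin n)).powersetCard (m + 1), fullDet H S =
        ∑ T ∈ (Finset.univ.erase i).powersetCard (m + 1), fullDet H T +
          ∑ T ∈ (Finset.univ.erase i).powersetCard m, fullDet H (insert i T) := by
      rw [← Finset.insert_erase (Finset.mem_univ i),
        Finset.powersetCard_succ_insert (Finset.notMem_erase i _),
        Finset.erase_insert (Finset.notMem_erase i _), Finset.sum_union, Finset.sum_image]
      · intro T h T' h' heq
        rw [← Finset.erase_insert (hT m T h), heq, Finset.erase_insert (hT m T' h')]
      · rw [Finset.disjoint_left]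
        intro T h h'
        obtain ⟨T', _, rfl⟩ := Finset.mem_image.1 h'
        exact hT _ _ h (Finset.mem_insert_self _ _)
    rw [sum_powersetCard_sum_erase _ m (fun a T => c a * rowDet H (H a) i T),
      ← Finset.add_sum_erase _ _ (Finset.mem_univ i), Finset.sum_congr rfl hoff, hdiag, hminor,
      mul_add]
    abel

theorem trace_minorAdjugate_succ (m : ℕ) (A : Matrix (Fin n) (Fin n) ℍ[ℝ]) :
    ∑ i, minorAdjugate (m + 1) A i i = (n - m) • minorSum m A := by
  have h : ∀ i, minorAdjugate (m + 1) A i i =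
      ∑ T ∈ (Finset.univ.erase i).powersetCard m, fullDet A T := by
    intro i
    change rdetSum (m + 1) A i (Pi.single i 1) = _
    rw [rdetSum_succ]
    refine Finset.sum_congr rfl fun T hT => ?_
    have hi : i ∉ T := fun h => by simpa using (Finset.mem_powersetCard.1 hT).1 h
    rw [rowDet_expand A _ hi, Pi.single_eq_same, one_mul, sub_eq_self]
    refine Finset.sum_eq_zero fun c hc => ?_
    rw [Pi.single_eq_of_ne (by rintro rfl; exact hi hc), zero_mul]
  rw [Finset.sum_congr rfl fun i _ => h i, minorSum_eq, Finset.smul_sum,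
    Finset.sum_comm' (t' := Finset.univ.powersetCard m) (s' := fun T => Tᶜ)]
  · refine Finset.sum_congr rfl fun T hT => ?_
    rw [Finset.sum_const, Finset.card_compl, Fintype.card_fin, (Finset.mem_powersetCard.1 hT).2]
  · intro i T
    simp only [Finset.mem_univ, true_and, Finset.mem_powersetCard, Finset.subset_erase,
      Finset.subset_univ, Finset.mem_compl]

theorem exists_minorSum_eq_coe {H : Matrix (Fin n) (Fin n) ℍ[ℝ]} (hH : H.IsHermitian) (m : ℕ) :
    ∃ d : ℝ, minorSum m H = (d : ℍ[ℝ]) := by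
  have : minorSum m H ∈ (⊥ : Subalgebra ℝ ℍ[ℝ]) := by
    rw [minorSum_eq]
    exact sum_mem fun S _ => fullDet_mem_bot hH S
  obtain ⟨d, hd⟩ := Algebra.mem_bot.1 this
  exact ⟨d, hd.symm⟩

/-- The Faddeev–LeVerrier recursion. -/
theorem minorAdjugate_succ {H : Matrix (Fin n) (Fin n) ℍ[ℝ]} (hH : H.IsHermitian) {m : ℕ} {d : ℝ}
    (hd : minorSum m H = (d : ℍ[ℝ])) :
    minorAdjugate (m + 1) H = d • (1 : Matrix (Fin n) (Fin n) ℍ[ℝ]) - H * minorAdjugate m H := by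
  rw [eq_sub_iff_add_eq]
  funext s i
  have h := rdetSum_recursion hH m i (Pi.single s 1)
  rw [Matrix.single_one_vecMul, rdetSum_eq_vecMul m, hd] at h
  rw [Matrix.add_apply, Matrix.mul_apply_eq_vecMul]
  refine h.trans ?_
  rw [Matrix.smul_apply, Matrix.one_apply, Pi.single_apply]
  by_cases his : i = s
  · simp [his, Algebra.smul_def]
  · simp [his, Ne.symm his]

theorem commute_minorAdjugate {H : Matrix (Fin n) (Fin n) ℍ[ℝ]} (hH : H.IsHermitian) (m : ℕ) :
    Commute H (minorAdjugate m H) := by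
  induction m with
  | zero =>
    have : minorAdjugate 0 H = 0 := by
      funext s i
      exact rdetSum_zero H i _
    rw [this]
    exact Commute.zero_right H
  | succ m ih =>
    obtain ⟨d, hd⟩ := exists_minorSum_eq_coe hH m
    rw [minorAdjugate_succ hH hd]
    exact ((Commute.one_right H).smul_right d).sub_right ((Commute.refl H).mul_right ih)

theorem minorAdjugate_card_succ (A : Matrix (Fin n) (Fin n) ℍ[ℝ]) :
    minorAdjugate (n + 1) A = 0 := by
  funext s i
  change rdetSum (n + 1) A i _ = 0
  rw [rdetSum_succ, Finset.powersetCard_eq_empty.2, Finset.sum_empty]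
  rw [Finset.card_erase_of_mem (Finset.mem_univ i), Finset.card_univ, Fintype.card_fin]
  have := i.pos
  omega

/-- The last nonzero sum of principal minors of a Hermitian matrix is the one of order the rank,
and the corresponding adjugate inverts the matrix on its row space. -/
theorem minorAdjugate_qrank {H : Matrix (Fin n) (Fin n) ℍ[ℝ]} (hH : H.IsHermitian) :
    ∃ d : ℝ, d ≠ 0 ∧ minorSum (qrank H) H = (d : ℍ[ℝ]) ∧
      H * (H * minorAdjugate (qrank H) H) = d • H := by
  classical
  choose d hd using exists_minorSum_eq_coe hH
  have hd0 : d 0 ≠ 0 := by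
    intro h
    have h0 := hd 0
    rw [minorSum_eq, Finset.powersetCard_zero, Finset.sum_singleton, fullDet_empty, h] at h0
    simp at h0
  set s := Nat.findGreatest (fun m => d m ≠ 0) n with hs
  have hds : d s ≠ 0 := Nat.findGreatest_spec (P := fun m => d m ≠ 0) (Nat.zero_le n) hd0
  have hsn : s ≤ n := Nat.findGreatest_le n
  have hgt : ∀ m, s < m → m ≤ n → d m = 0 := fun m h1 h2 =>
    not_not.1 (Nat.findGreatest_is_greatest (P := fun m => d m ≠ 0) h1 h2)
  -- Above `s` the recursion is multiplication by `-H`, and it ends in `0`.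
  have hiter : ∀ j, s + 1 + j ≤ n + 1 →
      minorAdjugate (s + 1) H * H ^ j = (-1) ^ j * minorAdjugate (s + 1 + j) H := by
    intro j
    induction j with
    | zero => intro _; simp
    | succ j ih =>
      intro hj
      rw [← add_assoc, minorAdjugate_succ hH (hd (s + 1 + j)),
        hgt (s + 1 + j) (by omega) (by omega), zero_smul, zero_sub,
        (commute_minorAdjugate hH (s + 1 + j)).eq, pow_succ, ← mul_assoc, ih (by omega), pow_succ]
      simp only [mul_assoc, mul_neg, neg_mul, one_mul, neg_neg]
  have hkill : minorAdjugate (s + 1) H * H = 0 := by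
    apply mul_eq_zero_of_mul_pow hH (n - s)
    rw [hiter (n - s) (by omega), show s + 1 + (n - s) = n + 1 by omega, minorAdjugate_card_succ,
      mul_zero]
  set B := minorAdjugate s H with hB
  have hBs := minorAdjugate_succ hH (hd s)
  have hcomm : H * B = B * H := (commute_minorAdjugate hH s).eq
  have hHHB : H * (H * B) = d s • H := by
    rw [hBs, sub_mul, smul_mul_assoc, one_mul, sub_eq_zero] at hkill
    rw [hkill, hcomm, ← mul_assoc, hcomm]
  -- `E` is an idempotent with the row space of `H`; its trace, known from the trace of the
  -- adjugate, identifies `s` as the rank.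
  set E := (d s)⁻¹ • (H * B) with hEdef
  have hHE : H * E = H := by
    rw [hEdef, mul_smul_comm, hHHB, smul_smul, inv_mul_cancel₀ hds, one_smul]
  have hEE : E * E = E := by
    have hE' : E = (d s)⁻¹ • (B * H) := by rw [hEdef, hcomm]
    calc E * E = ((d s)⁻¹ • (B * H)) * E := by rw [← hE']
      _ = E := by rw [smul_mul_assoc, mul_assoc, hHE, hE']
  have hrank : qrank E = qrank H := by
    refine qrank_eq_of_mul_eq hHE (Y := (d s)⁻¹ • B) ?_
    rw [smul_mul_assoc, ← hcomm]
  have htr : (∑ i, E i i).re = s := by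
    have h1 : E = 1 - (d s)⁻¹ • minorAdjugate (s + 1) H := by
      rw [hBs, smul_sub, smul_smul, inv_mul_cancel₀ hds, one_smul, sub_sub_cancel]
    have h2 : ∑ i, (minorAdjugate (s + 1) H i i).re = ((n : ℝ) - s) * d s := by
      rw [← re_sum, trace_minorAdjugate_succ, hd, ← Nat.cast_smul_eq_nsmul ℝ, Quaternion.re_smul,
        Quaternion.re_coe, smul_eq_mul, Nat.cast_sub hsn]
    rw [h1, re_sum]
    simp only [Matrix.sub_apply, Matrix.one_apply_eq, Matrix.smul_apply, Quaternion.re_sub,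
      Quaternion.re_one, Quaternion.re_smul, Finset.sum_sub_distrib, ← Finset.smul_sum]
    rw [h2]
    simp only [Finset.sum_const, Finset.card_univ, Fintype.card_fin, nsmul_eq_mul, mul_one,
      smul_eq_mul]
    field_simp
    ring
  have hsr : s = qrank H := by
    rw [re_trace_eq_qrank_of_idempotent hEE, hrank] at htr
    exact_mod_cast htr.symm
  rw [← hsr]
  exact ⟨d s, hds, hd s, hHHB⟩

end Adjugate

/-! ### The Drazin inverse -/

section Drazin

variable {n : ℕ}

theorem IsDrazinInverse.pow_mul_pow {A D : Matrix (Fin n) (Fin n) ℍ[ℝ]} {k : ℕ}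
    (h : IsDrazinInverse A k D) (j : ℕ) : A ^ (k + j) * D ^ j = A ^ k := by
  induction j with
  | zero => simp
  | succ j ih =>
    have h1 : A ^ (k + j + 1) * D = A ^ (k + j) := by
      rw [show k + j + 1 = j + (k + 1) by omega, pow_add, mul_assoc, h.pow_succ_mul, ← pow_add,
        add_comm j k]
    rw [pow_succ', ← mul_assoc, ← add_assoc, h1, ih]

theorem IsDrazinInverse.eq_pow_mul {A D : Matrix (Fin n) (Fin n) ℍ[ℝ]} {k : ℕ}
    (h : IsDrazinInverse A k D) (j : ℕ) : D = D ^ (j + 1) * A ^ j := by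
  induction j with
  | zero => simp
  | succ j ih =>
    have hc : D * D * A = D := by rw [mul_assoc, ← h.comm, ← mul_assoc, h.outer]
    calc D = D ^ j * (D * D * A) * A ^ j := by rw [hc, ← pow_succ, ← ih]
      _ = D ^ (j + 1 + 1) * A ^ (j + 1) := by
        rw [pow_succ' A, pow_succ D (j + 1), pow_succ D j]
        simp only [mul_assoc]

theorem IsDrazinInverse.unique {A D D' : Matrix (Fin n) (Fin n) ℍ[ℝ]} {k : ℕ}
    (h : IsDrazinInverse A k D) (h' : IsDrazinInverse A k D') : D' = D := by
  have hDA : Commute D A := h.comm.symm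
  have hDA' : Commute D' A := h'.comm.symm
  have e1 : D' * A * D = D' := by
    conv_lhs => rw [h'.eq_pow_mul k]
    rw [mul_assoc (D' ^ (k + 1)), ← pow_succ, mul_assoc, h.pow_succ_mul, ← h'.eq_pow_mul]
  have e2 : D' * A * D = D := by
    conv_lhs => rw [h.eq_pow_mul k, (hDA.pow_pow (k + 1) k).eq]
    rw [mul_assoc, ← mul_assoc A, ← pow_succ', ← mul_assoc, (hDA'.pow_right (k + 1)).eq,
      h'.pow_succ_mul, ← (hDA.pow_pow (k + 1) k).eq, ← h.eq_pow_mul]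
  rw [← e1, e2]

/-- An inner inverse `G` of `A ^ (2 * k + 1)` gives the Drazin inverse `A ^ k * G * A ^ k` once
the powers of `A` have become stationary at `k` on both sides. -/
theorem isDrazinInverse_of_inner_inverse {A G Y : Matrix (Fin n) (Fin n) ℍ[ℝ]} {k : ℕ}
    (hG : A ^ (2 * k + 1) * G * A ^ (2 * k + 1) = A ^ (2 * k + 1))
    (hY : Y * A ^ (2 * k + 1) = A ^ k)
    (hker : ∀ E : Matrix (Fin n) (Fin n) ℍ[ℝ], E * A ^ (2 * k + 1) = 0 → E * A ^ k = 0) :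
    IsDrazinInverse A k (A ^ k * G * A ^ k) := by
  set D := A ^ k * G * A ^ k with hD
  have hM1 : A ^ k * A ^ (k + 1) = A ^ (2 * k + 1) := by rw [← pow_add]; congr 1; omega
  have hM2 : A ^ (k + 1) * A ^ k = A ^ (2 * k + 1) := by rw [← pow_add]; congr 1; omega
  have hl : D * A ^ (k + 1) = A ^ k := by
    rw [hD, mul_assoc, hM1]
    conv_lhs => rw [← hY]
    rw [mul_assoc, mul_assoc, ← mul_assoc _ G, hG, hY]
  have hMG : A ^ (2 * k + 1) * G * A ^ k = A ^ k := by
    have h := hker (A ^ (2 * k + 1) * G - 1) (by rw [sub_mul, hG, one_mul, sub_self])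
    rw [sub_mul, one_mul, sub_eq_zero] at h
    exact h
  have hr : A ^ (k + 1) * D = A ^ k := by
    rw [hD, ← mul_assoc, ← mul_assoc, hM2, hMG]
  have hl' : ∀ j l, D ^ j * A ^ (k + j + l) = A ^ (k + l) := by
    intro j
    induction j with
    | zero => simp
    | succ j ih =>
      intro l
      rw [pow_succ, mul_assoc, show k + (j + 1) + l = (k + 1) + (j + l) by omega, pow_add A (k + 1),
        ← mul_assoc D, hl, ← pow_add, ← add_assoc, ih]
  have hr' : ∀ j l, A ^ (k + j + l) * D ^ j = A ^ (k + l) := by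
    intro j
    induction j with
    | zero => simp
    | succ j ih =>
      intro l
      rw [pow_succ', ← mul_assoc, show k + (j + 1) + l = (j + l) + (k + 1) by omega,
        pow_add A (j + l), mul_assoc (A ^ (j + l)), hr, ← pow_add,
        show j + l + k = k + j + l by omega, ih]
  -- Both `A * D` and `D * A` equal the projection `D ^ k * A ^ (2 * k) * D ^ k`.
  have hkk : A ^ k * D ^ k = D ^ k * A ^ k := by
    have h1 := hl' k 0
    have h2 := hr' k 0
    rw [add_zero, add_zero] at h1 h2
    calc A ^ k * D ^ k = D ^ k * A ^ (k + k) * D ^ k := by rw [h1]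
      _ = D ^ k * A ^ k := by rw [mul_assoc, h2]
  have hAD : A * D = D ^ k * A ^ k := by
    have h1 := hl' k 1
    rw [show k + k + 1 = 2 * k + 1 by omega] at h1
    calc A * D = A ^ (k + 1) * G * A ^ k := by rw [hD, pow_succ' A k]; simp only [mul_assoc]
      _ = D ^ k * (A ^ (2 * k + 1) * G * A ^ k) := by rw [← h1]; simp only [mul_assoc]
      _ = D ^ k * A ^ k := by rw [hMG]
  have hDA : D * A = A ^ k * D ^ k := by
    have h1 := hr' k 1
    rw [show k + k + 1 = 2 * k + 1 by omega] at h1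
    calc D * A = A ^ k * G * A ^ (k + 1) := by rw [hD, pow_succ A k]; simp only [mul_assoc]
      _ = A ^ k * G * A ^ (2 * k + 1) * D ^ k := by rw [← h1]; simp only [mul_assoc]
      _ = D * A ^ (k + 1) * D ^ k := by rw [hD, mul_assoc (A ^ k * G) (A ^ k), hM1]
      _ = A ^ k * D ^ k := by rw [hl]
  refine ⟨?_, by rw [hAD, hDA, hkk], hr⟩
  have hADk : A * D * A ^ k = A ^ k := by
    rw [hAD, ← hkk, ← hDA, mul_assoc, ← pow_succ', hl]
  calc D * A * D = A * D * D := by rw [hAD, hDA, hkk]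
    _ = A * D * A ^ k * (G * A ^ k) := by
      conv_lhs => rw [mul_assoc, hD]
      simp only [hD, mul_assoc]
    _ = D := by rw [hADk, hD, mul_assoc]

/-- Equality of the ranks of two consecutive powers makes their row spaces equal. -/
theorem exists_mul_pow_succ_eq {A : Matrix (Fin n) (Fin n) ℍ[ℝ]} {k : ℕ}
    (h : qrank (A ^ (k + 1)) = qrank (A ^ k)) :
    ∃ Y : Matrix (Fin n) (Fin n) ℍ[ℝ], Y * A ^ (k + 1) = A ^ k := by
  rw [qrank_eq_finrank_range, qrank_eq_finrank_range] at h
  have hle : LinearMap.range (A ^ (k + 1)).vecMulLinear ≤ LinearMap.range (A ^ k).vecMulLinear := by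
    rw [pow_succ']
    exact range_vecMulLinear_mul_le A (A ^ k)
  have heq := Submodule.eq_of_le_of_finrank_eq hle h
  have hx : ∀ i, ∃ x, x ᵥ* A ^ (k + 1) = (A ^ k) i := by
    intro i
    have : (A ^ k) i ∈ LinearMap.range (A ^ k).vecMulLinear :=
      ⟨Pi.single i 1, Matrix.single_one_vecMul i (A ^ k)⟩
    rw [← heq] at this
    exact this
  choose Y hY using hx
  exact ⟨Matrix.of Y, funext fun i => (Matrix.mul_apply_eq_vecMul _ _ i).trans (hY i)⟩

theorem exists_mul_pow_eq {A : Matrix (Fin n) (Fin n) ℍ[ℝ]} {k : ℕ}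
    (h : qrank (A ^ (k + 1)) = qrank (A ^ k)) (j : ℕ) :
    ∃ Y : Matrix (Fin n) (Fin n) ℍ[ℝ], Y * A ^ (k + j) = A ^ k := by
  obtain ⟨Y, hY⟩ := exists_mul_pow_succ_eq h
  refine ⟨Y ^ j, ?_⟩
  induction j with
  | zero => simp
  | succ j ih =>
    rw [pow_succ, mul_assoc, show k + (j + 1) = (k + 1) + j by omega, pow_add A (k + 1),
      ← mul_assoc Y, hY, ← pow_add, ih]

/-- If `P * Y` has the rank of `P`, then right multiplication by `Y` is injective on the row space
of `P`. -/
theorem mul_eq_zero_of_qrank_mul_eq {M P Y : Matrix (Fin n) (Fin n) ℍ[ℝ]} (hPM : P * Y = M)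
    (h : qrank M = qrank P) {E : Matrix (Fin n) (Fin n) ℍ[ℝ]} (hE : E * M = 0) : E * P = 0 := by
  have hle : LinearMap.ker P.vecMulLinear ≤ LinearMap.ker M.vecMulLinear := by
    intro x hx
    rw [LinearMap.mem_ker, Matrix.vecMulLinear_apply] at hx ⊢
    rw [← hPM, ← Matrix.vecMul_vecMul, hx, Matrix.zero_vecMul]
  have h1 := LinearMap.finrank_range_add_finrank_ker M.vecMulLinear
  have h2 := LinearMap.finrank_range_add_finrank_ker P.vecMulLinear
  rw [← qrank_eq_finrank_range] at h1 h2
  have heq := Submodule.eq_of_le_of_finrank_eq hle (by omega)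
  funext i
  have hi : E i ∈ LinearMap.ker M.vecMulLinear := by
    rw [LinearMap.mem_ker, Matrix.vecMulLinear_apply, ← Matrix.mul_apply_eq_vecMul, hE]
    rfl
  rw [← heq, LinearMap.mem_ker, Matrix.vecMulLinear_apply, ← Matrix.mul_apply_eq_vecMul] at hi
  exact hi

/-- The determinantal inner inverse of `M`: it is `Mᴴ` times the adjugate of `M * Mᴴ`. -/
theorem inner_inverse_minorAdjugate (M : Matrix (Fin n) (Fin n) ℍ[ℝ]) :
    ∃ d : ℝ, d ≠ 0 ∧ minorSum (qrank M) (M * Mᴴ) = (d : ℍ[ℝ]) ∧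
      M * (Mᴴ * minorAdjugate (qrank M) (M * Mᴴ)) * M = d • M := by
  have hN : (M * Mᴴ).IsHermitian := Matrix.isHermitian_mul_conjTranspose_self M
  obtain ⟨d, hd0, hd, hB⟩ := minorAdjugate_qrank hN
  have hcomm := (commute_minorAdjugate hN (qrank (M * Mᴴ))).eq
  rw [qrank_mul_conjTranspose_self] at hd hB hcomm
  refine ⟨d, hd0, hd, ?_⟩
  set B := minorAdjugate (qrank M) (M * Mᴴ)
  have h : (M * (Mᴴ * B) - d • 1) * (M * Mᴴ) = 0 := by
    rw [sub_mul, ← mul_assoc M, mul_assoc, ← hcomm, hB, smul_mul_assoc, one_mul, sub_self]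
  have h2 := mul_eq_zero_of_mul_conjTranspose h
  rw [sub_mul, smul_mul_assoc, one_mul, sub_eq_zero] at h2
  exact h2

theorem qrank_pow_two_mul_add_one {A : Matrix (Fin n) (Fin n) ℍ[ℝ]} {k : ℕ}
    (h : qrank (A ^ (k + 1)) = qrank (A ^ k)) : qrank (A ^ (2 * k + 1)) = qrank (A ^ k) := by
  obtain ⟨Y, hY⟩ := exists_mul_pow_eq h (k + 1)
  rw [show k + (k + 1) = 2 * k + 1 by omega] at hY
  refine qrank_eq_of_mul_eq hY (Y := A ^ (k + 1)) ?_
  rw [← pow_add]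
  congr 1
  omega

theorem exists_isDrazinInverse {A : Matrix (Fin n) (Fin n) ℍ[ℝ]} {k : ℕ}
    (h : qrank (A ^ (k + 1)) = qrank (A ^ k)) : ∃ D, IsDrazinInverse A k D := by
  obtain ⟨d, hd0, -, hG⟩ := inner_inverse_minorAdjugate (A ^ (2 * k + 1))
  set X := (A ^ (2 * k + 1))ᴴ * minorAdjugate (qrank (A ^ (2 * k + 1)))
    (A ^ (2 * k + 1) * (A ^ (2 * k + 1))ᴴ)
  obtain ⟨Y, hY⟩ := exists_mul_pow_eq h (k + 1)
  rw [show k + (k + 1) = 2 * k + 1 by omega] at hY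
  refine ⟨_, isDrazinInverse_of_inner_inverse (G := d⁻¹ • X) ?_ hY fun E hE => ?_⟩
  · rw [mul_smul_comm, smul_mul_assoc, hG, smul_smul, inv_mul_cancel₀ hd0, one_smul]
  · refine mul_eq_zero_of_qrank_mul_eq (Y := A ^ (k + 1)) ?_ (qrank_pow_two_mul_add_one h) hE
    rw [← pow_add]
    congr 1
    omega

/-- With `v m = b A ^ m - b A ^ (m + 1) D` the sum is a truncated exponential series, `v m * A` is
`v (m + 1)`, and the truncation at `k` is harmless because `v k = 0`. -/
theorem hasDerivAt_partialSolution {A D : Matrix (Fin n) (Fin n) ℍ[ℝ]} {k : ℕ}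
    (h : IsDrazinInverse A k D) (b : Fin n → ℍ[ℝ]) (t : ℝ) :
    HasDerivAt (partialSolution A D k b) (partialSolution A D k b t ᵥ* A + b) t := by
  set v : ℕ → Fin n → ℍ[ℝ] := fun m => b ᵥ* A ^ m - b ᵥ* (A ^ (m + 1) * D) with hv
  have hvk : v k = 0 := by simp [hv, h.pow_succ_mul]
  have hvA : ∀ m, v m ᵥ* A = v (m + 1) := by
    intro m
    simp only [hv, Matrix.sub_vecMul, Matrix.vecMul_vecMul]
    rw [mul_assoc, ← h.comm, ← mul_assoc, ← pow_succ, ← pow_succ]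
  have hsol : ∀ t : ℝ, partialSolution A D k b t =
      -(b ᵥ* D) + ∑ m ∈ Finset.range k, (t ^ (m + 1) / ((m + 1).factorial : ℝ)) • v m := by
    intro t
    unfold partialSolution
    rw [← Finset.Ico_add_one_right_eq_Icc, Finset.sum_Ico_eq_sum_range]
    congr 1
    refine Finset.sum_congr (by simp) fun m _ => ?_
    simp only [hv, add_comm 1 m, Nat.add_sub_cancel]
  have hrhs : partialSolution A D k b t ᵥ* A + b =
      ∑ m ∈ Finset.range k, (t ^ m / (m.factorial : ℝ)) • v m := by
    have h1 : ∑ m ∈ Finset.range (k + 1), (t ^ m / (m.factorial : ℝ)) • v m =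
        ∑ m ∈ Finset.range k, (t ^ m / (m.factorial : ℝ)) • v m := by
      rw [Finset.sum_range_succ, hvk, smul_zero, add_zero]
    rw [← h1, Finset.sum_range_succ', hsol, Matrix.add_vecMul, Matrix.neg_vecMul,
      Matrix.vecMul_vecMul, Matrix.sum_vecMul]
    simp only [Matrix.smul_vecMul, hvA]
    simp [hv, h.comm]
    abel
  rw [hrhs]
  have hfun : partialSolution A D k b = fun t : ℝ =>
      -(b ᵥ* D) + ∑ m ∈ Finset.range k, (t ^ (m + 1) / ((m + 1).factorial : ℝ)) • v m :=
    funext hsol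
  rw [hfun]
  apply HasDerivAt.const_add
  apply HasDerivAt.fun_sum
  intro m _
  apply HasDerivAt.smul_const
  have hd := (hasDerivAt_pow (m + 1) t).div_const ((m + 1).factorial : ℝ)
  convert hd using 1
  rw [Nat.factorial_succ]
  push_cast
  have : (m.factorial : ℝ) ≠ 0 := by exact_mod_cast m.factorial_ne_zero
  field_simp

/-- For Hermitian `A`, the adjugate of `A ^ (k + 1)` represents the Drazin inverse of `A`. -/
theorem pow_mul_minorAdjugate {A D : Matrix (Fin n) (Fin n) ℍ[ℝ]} {k : ℕ}
    (h : IsDrazinInverse A k D) (hA : A.IsHermitian) :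
    ∃ d : ℝ, d ≠ 0 ∧ minorSum (qrank (A ^ (k + 1))) (A ^ (k + 1)) = (d : ℍ[ℝ]) ∧
      A ^ k * minorAdjugate (qrank (A ^ (k + 1))) (A ^ (k + 1)) = d • D := by
  have hH : (A ^ (k + 1)).IsHermitian := hA.pow (k + 1)
  obtain ⟨d, hd0, hd, hB⟩ := minorAdjugate_qrank hH
  refine ⟨d, hd0, hd, ?_⟩
  have hcomm := (commute_minorAdjugate hH (qrank (A ^ (k + 1)))).eq
  set B := minorAdjugate (qrank (A ^ (k + 1))) (A ^ (k + 1))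
  have hDA : Commute D A := h.comm.symm
  have hl : D * A ^ (k + 1) = A ^ k := by rw [(hDA.pow_right (k + 1)).eq, h.pow_succ_mul]
  have h1 : A ^ k * B * A ^ (k + 1) = d • A ^ k := by
    rw [← hl, mul_assoc, mul_assoc, ← hcomm, hB, mul_smul_comm]
  have h2 : A ^ (k + 1) * D ^ (k + 1) = A * D := by
    have := h.eq_pow_mul k
    conv_rhs => rw [this]
    rw [(hDA.pow_pow (k + 1) k).eq, ← mul_assoc, ← pow_succ']
  have h3 : A ^ k * B * (A * D) = A ^ k * B := by
    have : A ^ k * B = D * B * A ^ (k + 1) := by rw [← hl, mul_assoc, hcomm, mul_assoc]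
    rw [this, mul_assoc, h.comm, ← mul_assoc (A ^ (k + 1)), h.pow_succ_mul, ← pow_succ]
  calc A ^ k * B = A ^ k * B * A ^ (k + 1) * D ^ (k + 1) := by rw [mul_assoc, h2, h3]
    _ = d • D := by
      rw [h1, smul_mul_assoc, ← (hDA.pow_pow (k + 1) k).eq, ← h.eq_pow_mul]

/-- For arbitrary `A`, the Drazin inverse is `A ^ k * G * A ^ k` with `G` the determinantal inner
inverse of `A ^ (2 * k + 1)`. -/
theorem pow_mul_minorAdjugate_mul_pow {A D : Matrix (Fin n) (Fin n) ℍ[ℝ]} {k : ℕ}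
    (h : IsDrazinInverse A k D) :
    ∃ d : ℝ, d ≠ 0 ∧ minorSum (qrank (A ^ (2 * k + 1)))
        (A ^ (2 * k + 1) * (A ^ (2 * k + 1))ᴴ) = (d : ℍ[ℝ]) ∧
      A ^ k * (A ^ (2 * k + 1))ᴴ * minorAdjugate (qrank (A ^ (2 * k + 1)))
        (A ^ (2 * k + 1) * (A ^ (2 * k + 1))ᴴ) * A ^ k = d • D := by
  obtain ⟨d, hd0, hd, hG⟩ := inner_inverse_minorAdjugate (A ^ (2 * k + 1))
  refine ⟨d, hd0, hd, ?_⟩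
  set M := A ^ (2 * k + 1) with hM
  set X := Mᴴ * minorAdjugate (qrank M) (M * Mᴴ)
  have hDA : Commute D A := h.comm.symm
  have hr : M * D ^ (k + 1) = A ^ k := by
    rw [hM, show 2 * k + 1 = k + (k + 1) by omega, h.pow_mul_pow]
  have hl : D ^ (k + 1) * M = A ^ k := by rw [hM, (hDA.pow_pow _ _).eq, ← hM, hr]
  calc A ^ k * Mᴴ * minorAdjugate (qrank M) (M * Mᴴ) * A ^ k
      = A ^ k * X * A ^ k := by simp only [X, mul_assoc]
    _ = D ^ (k + 1) * (M * X * M) * D ^ (k + 1) := by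
      conv_lhs => rw [← hr]
      conv_lhs => enter [1, 1]; rw [hr, ← hl]
      simp only [mul_assoc]
    _ = d • (D ^ (k + 1) * A ^ k) := by
      rw [hG, mul_smul_comm, smul_mul_assoc, mul_assoc, hr]
    _ = d • D := by rw [← h.eq_pow_mul]

theorem coe_ne_zero {d : ℝ} (hd : d ≠ 0) : (d : ℍ[ℝ]) ≠ 0 := fun h =>
  hd (by simpa using congrArg (fun q : ℍ[ℝ] => q.re) h)

theorem partialSolution_apply (A D : Matrix (Fin n) (Fin n) ℍ[ℝ]) (k : ℕ) (b : Fin n → ℍ[ℝ])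
    (t : ℝ) (i : Fin n) :
    partialSolution A D k b t i = -(b ᵥ* D) i + ∑ m ∈ Finset.Icc 1 k,
      (t ^ m / (m.factorial : ℝ)) • ((b ᵥ* A ^ (m - 1)) i - (b ᵥ* (A ^ m * D)) i) := by
  simp [partialSolution, Finset.sum_apply]

end Drazin

end QuatLin

/-! ### The solution of the linear system -/

theorem theorem3p17 {n : ℕ} (A : Matrix (Fin n) (Fin n) ℍ[ℝ]) (b : Fin n → ℍ[ℝ]) (k r : ℕ)
    (hk : QuatLin.IsIndex A k)
    (hr1 : QuatLin.qrank (A ^ (k + 1)) = r) (hr : QuatLin.qrank (A ^ k) = r) :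
    ∃ D : Matrix (Fin n) (Fin n) ℍ[ℝ],
      -- `D` is the Drazin inverse of `A`
      QuatLin.IsDrazinInverse A k D ∧
      (∀ D' : Matrix (Fin n) (Fin n) ℍ[ℝ], QuatLin.IsDrazinInverse A k D' → D' = D) ∧
      -- the function under consideration solves `x' = x A + b`
      (∀ t : ℝ, HasDerivAt (QuatLin.partialSolution A D k b)
        (QuatLin.partialSolution A D k b t ᵥ* A + b) t) ∧
      -- (i) Hermitian `A`
      (A.IsHermitian →
        QuatLin.minorSum r (A ^ (k + 1)) ≠ 0 ∧
        ∀ (t : ℝ) (i : Fin n),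
          QuatLin.partialSolution A D k b t i =
            -(QuatLin.rdetSum r (A ^ (k + 1)) i (b ᵥ* A ^ k) /
                QuatLin.minorSum r (A ^ (k + 1))) +
              ∑ m ∈ Finset.Icc 1 k, (t ^ m / (m.factorial : ℝ)) •
                ((b ᵥ* A ^ (m - 1)) i -
                  QuatLin.rdetSum r (A ^ (k + 1)) i (b ᵥ* A ^ (k + m)) /
                    QuatLin.minorSum r (A ^ (k + 1)))) ∧
      -- (ii) arbitrary `A`
      (QuatLin.minorSum r (A ^ (2 * k + 1) * (A ^ (2 * k + 1))ᴴ) ≠ 0 ∧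
        ∀ (t : ℝ) (i : Fin n),
          QuatLin.partialSolution A D k b t i =
            -((∑ s : Fin n,
                  QuatLin.rdetSum r (A ^ (2 * k + 1) * (A ^ (2 * k + 1))ᴴ) s
                    (b ᵥ* (A ^ k * (A ^ (2 * k + 1))ᴴ)) * (A ^ k) s i) /
                QuatLin.minorSum r (A ^ (2 * k + 1) * (A ^ (2 * k + 1))ᴴ)) +
              ∑ m ∈ Finset.Icc 1 k, (t ^ m / (m.factorial : ℝ)) •
                ((b ᵥ* A ^ (m - 1)) i -
                  (∑ s : Fin n,
                      QuatLin.rdetSum r (A ^ (2 * k + 1) * (A ^ (2 * k + 1))ᴴ) s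
                        (b ᵥ* (A ^ (k + m) * (A ^ (2 * k + 1))ᴴ)) * (A ^ k) s i) /
                    QuatLin.minorSum r (A ^ (2 * k + 1) * (A ^ (2 * k + 1))ᴴ))) := by
  have hrank := hr1.trans hr.symm
  obtain ⟨D, hD⟩ := QuatLin.exists_isDrazinInverse hrank
  refine ⟨D, hD, fun D' hD' => hD.unique hD', fun t => QuatLin.hasDerivAt_partialSolution hD b t,
    fun hA => ?_, ?_⟩
  · obtain ⟨d, hd0, hd, hB⟩ := QuatLin.pow_mul_minorAdjugate hD hA
    rw [hr1] at hd hB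
    have hd0' : (d : ℍ[ℝ]) ≠ 0 := QuatLin.coe_ne_zero hd0
    have key : ∀ m i, QuatLin.rdetSum r (A ^ (k + 1)) i (b ᵥ* A ^ (k + m)) /
        QuatLin.minorSum r (A ^ (k + 1)) = (b ᵥ* (A ^ m * D)) i := by
      intro m i
      rw [QuatLin.rdetSum_eq_vecMul, Matrix.vecMul_vecMul, add_comm k m, pow_add, mul_assoc, hB, hd,
        mul_smul_comm, Matrix.vecMul_smul, Pi.smul_apply, div_eq_iff hd0',
        ← Quaternion.coe_commutes, Quaternion.coe_mul_eq_smul]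
    refine ⟨by rw [hd]; exact hd0', fun t i => ?_⟩
    rw [QuatLin.partialSolution_apply]
    simp only [key]
    have key0 := key 0 i
    rw [add_zero, pow_zero, one_mul] at key0
    rw [key0]
  · obtain ⟨d, hd0, hd, hB⟩ := QuatLin.pow_mul_minorAdjugate_mul_pow hD
    rw [QuatLin.qrank_pow_two_mul_add_one hrank, hr] at hd hB
    set M := A ^ (2 * k + 1)
    have hd0' : (d : ℍ[ℝ]) ≠ 0 := QuatLin.coe_ne_zero hd0
    have key : ∀ m i, (∑ s : Fin n, QuatLin.rdetSum r (M * Mᴴ) s (b ᵥ* (A ^ (k + m) * Mᴴ)) *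
        (A ^ k) s i) / QuatLin.minorSum r (M * Mᴴ) = (b ᵥ* (A ^ m * D)) i := by
      intro m i
      have hsum : ∑ s : Fin n, QuatLin.rdetSum r (M * Mᴴ) s (b ᵥ* (A ^ (k + m) * Mᴴ)) *
          (A ^ k) s i =
          (b ᵥ* (A ^ (k + m) * Mᴴ) ᵥ* QuatLin.minorAdjugate r (M * Mᴴ) ᵥ* A ^ k) i :=
        Finset.sum_congr rfl fun s _ => by rw [QuatLin.rdetSum_eq_vecMul]
      have hmat : A ^ (k + m) * Mᴴ * QuatLin.minorAdjugate r (M * Mᴴ) * A ^ k =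
          d • (A ^ m * D) := by
        rw [← mul_smul_comm, ← hB, add_comm k m, pow_add]
        simp only [mul_assoc]
      rw [hsum, Matrix.vecMul_vecMul, Matrix.vecMul_vecMul, ← mul_assoc, hmat, hd,
        Matrix.vecMul_smul, Pi.smul_apply, div_eq_iff hd0', ← Quaternion.coe_commutes,
        Quaternion.coe_mul_eq_smul]
    refine ⟨by rw [hd]; exact hd0', fun t i => ?_⟩
    rw [QuatLin.partialSolution_apply]
    simp only [key]
    have key0 := key 0 i
    rw [add_zero, pow_zero, one_mul] at key0
    rw [key0]
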